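/- **Paths.** A *square path* of size $N$ is a lattice path from $(0,0)$ to $(N,N)$ with unit north and east steps, ending with an east step (or empty). Its *shift* is the largest $s$ such that it meets the line $y=x-s$; it is a *Dyck path* if its shift is $0$. The line $y=x+i-s$ is called the $i$-th diagonal. Its *area word* is $(a_1,\dots,a_N)$, where the $i$-th north step starts on the line $y=x+a_i$. A *partial labelling* is $w\in\mathbb N^N$ (with $0\in\mathbb N$) such that $a_i>a_{i-1}$ implies $w_i>w_{i-1}$; $a_1=0$ implies $w_1>0$; and, if $N>0$, some $i$ has $a_i=-s$ and $w_i>0$. The index $i$ is a *contractible valley* if either $i=1$ and ($a_1<-1$, or $a_1=-1$ and $w_1>0$), or $i>1$ and ($a_i<a_{i-1}$, or $a_i=a_{i-1}$ and $w_i>w_{i-1}$). A *valley-decorated partially labelled square path* is a triple $\pi=(\pi,w,dv)$, where $dv$ is a set of contractible valleys. Put $x^\pi=\prod_i x_{w_i}$ with $x_0=1$, $\mathsf{area}(\pi)=\sum_i(a_i+s)$, and $$\mathsf{dinv}(\pi)=\#\{i<j : (i,j)\text{ is an inversion},\ i\notin dv\}+\#\{i: a_i<0,\ w_i>0\}-\#dv,$$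 where $(i,j)$ with $i<j$ is an inversion if $a_i=a_j$ and $w_i<w_j$, or $a_i=a_j+1$ and $w_i>w_j$. **Words.** A marked word is a finite word in the letters $c$ and $\overset{\bullet}{c}$, $c\in\mathbb N$. The *diagonal word* $\mathsf{dw}(\pi)$ is obtained by writing, from the highest occupied diagonal down to the $0$-th, the labels on that diagonal, marked with a $\bullet$ if the valley is decorated, in increasing order with respect to $c<\overset{\bullet}{c}<c+1$. For a marked word $z$ let $z=\rho_\ell\cdots\rho_1\rho_0$ be its factorisation into runs, i.e. maximal weakly increasing factors (disregarding the marks); $\rho_i$ is empty for $i<0$ and for $i>\ell$. Let $\#\rho'_i$ be the number of unmarked positive letters of $\rho_i$, let $z_i^\bullet(0)$ be the number of marked zeros in $\rho_i$, and let $$b(z,s)=\sum_{i=0}^{s-1}\bigl(\#\rho'_i-z_{i-1}^\bullet(0)\bigr).$$ **Enumerators.** For a marked word $z$ and $s\ge 0$ let $$\mathsf{LSQ}_{q,t;x}(z,s)=\sum_{\pi}q^{\mathsf{dinv}(\pi)}t^{\mathsf{area}(\pi)}x^\pi ,$$ the sum over all valley-decorated partially labelled square paths $\pi$ of shift $s$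 with $\mathsf{dw}(\pi)=z$, and let $\mathsf{LD}_{q,t;x}(z)$ be the same sum over the Dyck paths with $\mathsf{dw}(\pi)=z$. Write $[m]_q=\frac{1-q^m}{1-q}$ for $m\in\mathbb Z$. **Statement.** Let $z$ be a marked word with $\#\rho'_0\ne 0$ and let $s\ge 0$. Then, as polynomials in the variables $x_i$ with coefficients in $\mathbb Q(q,t)$, $$\mathsf{LSQ}_{q,t;x}(z,s)=q^{b(z,s)}\,\frac{[\#\rho'_s-z_{s-1}^\bullet(0)]_q}{[\#\rho'_0]_q}\,\mathsf{LD}_{q,t;x}(z).$$ -/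

import Mathlib

namespace DeltaSquare

/-! ## Square paths -/

/-- Unit steps of a lattice path. -/
inductive Step
  | north
  | east
  deriving DecidableEq

instance : Finite Step :=
  Finite.of_injective (fun x : Step => decide (x = Step.north)) (by
    intro x y h
    cases x <;> cases y <;> simp_all)

/-- A square path of size `n`: a lattice path from `(0,0)` to `(n,n)` made of north and east unit
steps which (unless it is empty) ends with an east step. -/
structure SquarePath (n : ℕ) where
  steps : List Step
  count_north : steps.count Step.north = n
  count_east : steps.count Step.east = n
  ends_east : ∀ h : steps ≠ [], steps.getLast h = Step.east

/-- The value of `y - x` at the lattice point reached after the first `j` steps. -/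
def level (l : List Step) (j : ℕ) : ℤ :=
  ((l.take j).count Step.north : ℤ) - ((l.take j).count Step.east : ℤ)

/-- The values of `y - x` at the starting points of the north steps, for a sequence of steps that
starts at a point with `y - x = d`. -/
def startLevels : ℤ → List Step → List ℤ
  | _, [] => []
  | d, Step.north :: l => d :: startLevels (d + 1) l
  | d, Step.east :: l => startLevels (d - 1) l

theorem length_startLevels (d : ℤ) (l : List Step) :
    (startLevels d l).length = l.count Step.north := by
  induction l generalizing d with
  | nil => rfl
  | cons a l ih => cases a <;> simp [startLevels, ih]

theorem exists_level_of_mem_startLevels (d c : ℤ) (l : List Step) (h : d ∈ startLevels c l) :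
    ∃ j ≤ l.length, d = c + level l j := by
  induction l generalizing c with
  | nil => simp [startLevels] at h
  | cons a l ih =>
    cases a with
    | north =>
      simp only [startLevels, List.mem_cons] at h
      rcases h with rfl | h
      · exact ⟨0, by simp, by simp [level]⟩
      · obtain ⟨j, hj, rfl⟩ := ih _ h
        exact ⟨j + 1, by simpa using hj, by simp [level]; ring⟩
    | east =>
      simp only [startLevels] at h
      obtain ⟨j, hj, rfl⟩ := ih _ h
      exact ⟨j + 1, by simpa using hj, by simp [level]; ring⟩

namespace SquarePath

variable {n : ℕ}

/-- The shift: the maximal `s` such that the path meets the line `y = x - s`. -/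
def shift (π : SquarePath n) : ℕ :=
  (Finset.range (π.steps.length + 1)).sup fun j => (-level π.steps j).toNat

/-- A Dyck path is a square path of shift `0`. -/
def IsDyck (π : SquarePath n) : Prop := π.shift = 0

/-- The area word: the `i`-th north step starts on the line `y = x + a i` (rows are numbered
from `0`). -/
def a (π : SquarePath n) (i : Fin n) : ℤ :=
  (startLevels 0 π.steps)[i.val]'(by
    rw [length_startLevels, π.count_north]; exact i.isLt)

theorem a_add_shift_nonneg (π : SquarePath n) (i : Fin n) : 0 ≤ π.a i + π.shift := by
  obtain ⟨j, hj, h⟩ := exists_level_of_mem_startLevels (π.a i) 0 π.steps (List.getElem_mem _)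
  have h1 : (-level π.steps j).toNat ≤ π.shift :=
    Finset.le_sup (f := fun j => (-level π.steps j).toNat)
      (Finset.mem_range.2 (Nat.lt_succ_of_le hj))
  omega

theorem length_steps (l : List Step) :
    l.length = l.count Step.north + l.count Step.east := by
  induction l with
  | nil => rfl
  | cons a l ih => cases a <;> simp [ih] <;> omega

instance : Finite (SquarePath n) := by
  have : Finite {l : List Step // l.length = 2 * n} :=
    (List.finite_length_eq Step (2 * n)).to_subtype
  refine Finite.of_injective
    (fun π : SquarePath n => (⟨π.steps, by
      rw [length_steps, π.count_north, π.count_east]; ring⟩ :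
      {l : List Step // l.length = 2 * n})) ?_
  intro π π' h
  cases π; cases π'
  simpa using h

end SquarePath

/-! ## Labellings, contractible valleys, decorations -/

/-- `w` is a partial labelling of the square path `π`: labels strictly increase up the columns,
a label at the origin is positive, and some positive label lies on the base diagonal (the last
requirement is void for the empty path). -/
structure IsPartialLabelling {n : ℕ} (π : SquarePath n) (w : Fin n → ℕ) : Prop where
  column : ∀ i j : Fin n, i.val + 1 = j.val → π.a i < π.a j → w i < w j
  first : ∀ i : Fin n, i.val = 0 → π.a i = 0 → 0 < w i
  base : 0 < n → ∃ i : Fin n, π.a i = -(π.shift : ℤ) ∧ 0 < w i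

/-- The row `j` is a contractible valley of the labelled path `(π, w)`. -/
def IsContractibleValley {n : ℕ} (π : SquarePath n) (w : Fin n → ℕ) (j : Fin n) : Prop :=
  (j.val = 0 ∧ (π.a j < -1 ∨ (π.a j = -1 ∧ 0 < w j))) ∨
  ∃ i : Fin n, i.val + 1 = j.val ∧ (π.a j < π.a i ∨ (π.a j = π.a i ∧ w i < w j))

/-- Valley-decorated partially labelled square paths `(π, w, dv)` of size `n`. -/
structure ValleyPath (n : ℕ) where
  path : SquarePath n
  w : Fin n → ℕ
  dv : Finset (Fin n)
  labelling : IsPartialLabelling path w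
  contractible : ∀ j ∈ dv, IsContractibleValley path w j

/-- A letter: a label, together with `true` if it is decorated. The order is lexicographic, so that
`c < c• < c + 1`. -/
abbrev Letter := ℕ ×ₗ Bool

/-- The letter with label `c`, decorated if and only if `d` is `true`. -/
def Letter.mk (c : ℕ) (d : Bool) : Letter := toLex (c, d)

/-- The label of a letter. -/
def Letter.label (x : Letter) : ℕ := (ofLex x).1

/-- Whether a letter is decorated. -/
def Letter.decorated (x : Letter) : Bool := (ofLex x).2

/-- Marked words in the alphabet `ℕ`. -/
abbrev MarkedWord := List Letter

noncomputable section

/-- The field `ℚ(q, t)`. -/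
abbrev QT := FractionRing (MvPolynomial (Fin 2) ℚ)

/-- The variable `q`. -/
def q : QT := algebraMap (MvPolynomial (Fin 2) ℚ) QT (MvPolynomial.X 0)

/-- The variable `t`. -/
def t : QT := algebraMap (MvPolynomial (Fin 2) ℚ) QT (MvPolynomial.X 1)

/-- The `q`-analogue `[m]_q = (1 - q^m) / (1 - q)`. -/
def qInt (m : ℤ) : QT := (1 - q ^ m) / (1 - q)

namespace ValleyPath

variable {n : ℕ}

/-- The area (for valley decorations all rows count). -/
def area (P : ValleyPath n) : ℤ := ∑ i, (P.path.a i + P.path.shift)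

/-- The pair of rows `(i, j)` is a primary or a secondary inversion. -/
def IsInversion (P : ValleyPath n) (i j : Fin n) : Prop :=
  i < j ∧ ((P.path.a i = P.path.a j ∧ P.w i < P.w j) ∨
    (P.path.a i = P.path.a j + 1 ∧ P.w j < P.w i))

instance (P : ValleyPath n) (i j : Fin n) : Decidable (P.IsInversion i j) :=
  inferInstanceAs (Decidable (_ ∧ _))

/-- The dinv: inversions whose left row is not a decorated valley, plus positive labels below the
main diagonal, minus the number of decorations. -/
def dinv (P : ValleyPath n) : ℤ :=
  ((Finset.univ.filter fun p : Fin n × Fin n => P.IsInversion p.1 p.2 ∧ p.1 ∉ P.dv).card : ℤ)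
    + ((Finset.univ.filter fun i : Fin n => P.path.a i < 0 ∧ 0 < P.w i).card : ℤ)
    - (P.dv.card : ℤ)

/-- The monomial `x^w`, where `x_0 = 1`. -/
def monomial (P : ValleyPath n) : MvPolynomial ℕ QT :=
  ∏ i, if P.w i = 0 then 1 else MvPolynomial.X (P.w i)

/-- The letter in row `i`. -/
def letter (P : ValleyPath n) (i : Fin n) : Letter := Letter.mk (P.w i) (decide (i ∈ P.dv))

/-- The letters on the `d`-th diagonal `y = x + d - s`, in increasing order. -/
def diagonal (P : ValleyPath n) (d : ℕ) : MarkedWord :=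
  ((Finset.univ.filter fun i : Fin n => P.path.a i + P.path.shift = d).val.map P.letter).sort
    (· ≤ ·)

/-- The index of the highest diagonal that carries a label. -/
def top (P : ValleyPath n) : ℕ :=
  Finset.univ.sup fun i : Fin n => (P.path.a i + P.path.shift).toNat

/-- The diagonal word, read from the highest diagonal down to the base diagonal. -/
def diagonalWord (P : ValleyPath n) : MarkedWord :=
  (List.range (P.top + 1)).reverse.flatMap P.diagonal

theorem letter_mem_diagonalWord (P : ValleyPath n) (i : Fin n) :
    P.letter i ∈ P.diagonalWord := by
  have h := P.path.a_add_shift_nonneg i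
  have h1 : (P.path.a i + P.path.shift).toNat ≤ P.top :=
    Finset.le_sup (f := fun i : Fin n => (P.path.a i + P.path.shift).toNat) (Finset.mem_univ i)
  refine List.mem_flatMap.2 ⟨(P.path.a i + P.path.shift).toNat, ?_, ?_⟩
  · simpa using Nat.lt_succ_of_le h1
  · rw [diagonal, Multiset.mem_sort, Multiset.mem_map]
    exact ⟨i, by simp [Int.toNat_of_nonneg h], rfl⟩

theorem finite_diagonalWord_eq (n : ℕ) (z : MarkedWord) :
    {P : ValleyPath n | P.diagonalWord = z}.Finite := by
  rw [← Set.finite_coe_iff]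
  refine Finite.of_injective
    (β := SquarePath n × (Fin n → {x : Letter // x ∈ z.toFinset}))
    (fun P => (P.1.path, fun i => ⟨P.1.letter i, by
      have h := P.1.letter_mem_diagonalWord i
      rw [P.2] at h
      simpa using h⟩)) ?_
  rintro ⟨⟨p, w, dv, h1, h2⟩, h3⟩ ⟨⟨p', w', dv', h1', h2'⟩, h3'⟩ h
  simp only [Prod.mk.injEq, funext_iff, Subtype.mk.injEq, letter, Letter.mk,
    EmbeddingLike.apply_eq_iff_eq] at h
  obtain ⟨rfl, h⟩ := h
  obtain rfl : w = w' := funext fun i => (h i).1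
  obtain rfl : dv = dv' := Finset.ext fun i => by simpa using (h i).2
  rfl

end ValleyPath

/-! ## Enumerators with a given diagonal word

A path with diagonal word `z` has as many rows as `z` has letters, and its numbers of zero labels,
positive labels and decorations can be read off from `z`. -/

/-- The valley-decorated partially labelled square paths of diagonal word `z` and shift `s`. -/
def pathsWithShift (z : MarkedWord) (s : ℕ) : Set (ValleyPath z.length) :=
  {P | P.diagonalWord = z ∧ P.path.shift = s}

/-- The valley-decorated partially labelled Dyck paths of diagonal word `z`. -/
def dyckPaths (z : MarkedWord) : Set (ValleyPath z.length) :=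
  {P | P.diagonalWord = z ∧ P.path.IsDyck}

theorem finite_pathsWithShift (z : MarkedWord) (s : ℕ) : (pathsWithShift z s).Finite :=
  (ValleyPath.finite_diagonalWord_eq _ z).subset fun _ h => h.1

theorem finite_dyckPaths (z : MarkedWord) : (dyckPaths z).Finite :=
  (ValleyPath.finite_diagonalWord_eq _ z).subset fun _ h => h.1

/-- The summand `q^dinv t^area x^w`. -/
def ValleyPath.weight {n : ℕ} (P : ValleyPath n) : MvPolynomial ℕ QT :=
  MvPolynomial.C (q ^ P.dinv * t ^ P.area) * P.monomial

/-- The enumerator `LSQ_{q,t;x}(z,s)`. -/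
def LSQ (z : MarkedWord) (s : ℕ) : MvPolynomial ℕ QT :=
  ∑ P ∈ (finite_pathsWithShift z s).toFinset, P.weight

/-- The enumerator `LD_{q,t;x}(z)`. -/
def LD (z : MarkedWord) : MvPolynomial ℕ QT :=
  ∑ P ∈ (finite_dyckPaths z).toFinset, P.weight

end

/-! ## Runs of a marked word -/

/-- The maximal weakly increasing factors of `z` (disregarding decorations), from left to right. -/
def runs (z : MarkedWord) : List MarkedWord :=
  z.splitBy fun x y => decide (x.label ≤ y.label)

/-- The run `ρ_i`, where `z = ρ_ℓ ⋯ ρ_1 ρ_0`; it is empty if `i < 0` or `i > ℓ`. -/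
def run (z : MarkedWord) (i : ℤ) : MarkedWord :=
  if 0 ≤ i then (runs z).reverse.getD i.toNat [] else []

/-- The word `ρ'_i` of undecorated positive letters of `ρ_i`. -/
def runPos (z : MarkedWord) (i : ℤ) : MarkedWord :=
  (run z i).filter fun x => !x.decorated && decide (0 < x.label)

/-- The number `z_i^•(c)` of decorated letters of `ρ_i` with label `c`. -/
def decMult (z : MarkedWord) (i : ℤ) (c : ℕ) : ℕ :=
  (run z i).count (Letter.mk c true)

/-- The exponent `b(z,s)`, the sum of `#ρ'_i - z_{i-1}^•(0)` over `0 ≤ i < s`. -/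
def b (z : MarkedWord) (s : ℕ) : ℤ :=
  ∑ i ∈ Finset.range s, (((runPos z i).length : ℤ) - (decMult z ((i : ℤ) - 1) 0 : ℤ))

end DeltaSquare

/-! Record each north step of a path of shift `s` as a row (level above the base diagonal, label,
decoration). A path becomes a word of rows: neighbours satisfy `RowAdj`, a virtual first row at
level `s - 1` with label `0` encodes the conditions at the origin, and the last row has level at
least `s`. A path climbs between adjacent diagonals only with increasing labels, so the runs of the
diagonal word are exactly the diagonals, and `z` determines the multiset `M` of rows. Area, monomial
and the part of dinv not coming from inversions depend only on `M` and `s`; it remains to compare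
`rowSum s M` with `rowSum 0 M`.

Such a sum is computed by deleting all copies of one row `x`. If the gaps that can receive `x` carry
a geometric progression of weights not depending on the remaining word, the sum factors as a
symmetric polynomial of these weights times the sum for the remaining rows: elementary if `x` cannot
follow itself, complete homogeneous if it can. This applies to every decorated row and, among
undecorated rows, to the smallest one on the top diagonal and the largest one on the bottom
diagonal.

Let P_i be the number of undecorated positive labels on diagonal i. Without decorations, rows above
diagonal s + 1 or below s contribute equally to the shifts s and s + 1, which leaves two diagonals.
Stripping the upper one (shift s) or the lower one (shift s + 1) produces rising factorials with the
same bases, and they telescope to [P_s] rowSum(s+1) = [P_{s+1}] rowSum(s). Iteration gives [P_0]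
rowSum(s) = [P_s] rowSum(0).

A decorated row below diagonal s costs one factor q less at shift s than at shift 0. The exception
is a marked zero on diagonal s - 1, which instead loses a gap; k such zeros turn [P_s] into [P_s -
k]. Balancing these powers of q against the positive labels below the main diagonal leaves q^b(z,s).
-/

namespace DeltaSquare

/-! ## Inserting copies of a letter into a word -/

section Insertion

variable {α A : Type*} [DecidableEq α] [CommSemiring A]

/-- Elementary symmetric polynomials of the entries of a list. -/
def esymmList : List A → ℕ → A
  | _, 0 => 1
  | [], _ + 1 => 0
  | a :: L, m + 1 => esymmList L (m + 1) + a * esymmList L m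

/-- Complete homogeneous symmetric polynomials of the entries of a list. -/
def hsymmList : List A → ℕ → A
  | _, 0 => 1
  | [], _ + 1 => 0
  | a :: L, m + 1 => hsymmList L (m + 1) + a * hsymmList (a :: L) m

@[simp] theorem esymmList_zero (L : List A) : esymmList L 0 = 1 := by
  cases L <;> simp [esymmList]

@[simp] theorem hsymmList_zero (L : List A) : hsymmList L 0 = 1 := by
  cases L <;> simp [hsymmList]

theorem esymmList_map_mul (c : A) (L : List A) (m : ℕ) :
    esymmList (L.map (c * ·)) m = c ^ m * esymmList L m := by
  induction L generalizing m with
  | nil => cases m <;> simp [esymmList]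
  | cons a L ih =>
    cases m with
    | zero => simp
    | succ m => simp only [List.map_cons, esymmList, ih]; ring

theorem hsymmList_map_mul (c : A) (L : List A) (m : ℕ) :
    hsymmList (L.map (c * ·)) m = c ^ m * hsymmList L m := by
  induction L generalizing m with
  | nil => cases m <;> simp [hsymmList]
  | cons a L ih =>
    induction m with
    | zero => simp
    | succ m ihm =>
      rw [List.map_cons] at ihm
      simp only [List.map_cons, hsymmList, ih, ihm]; ring

/-- The words obtained from `b` by inserting `m` copies of `x`. -/
def insertions (x : α) : List α → ℕ → List (List α)
  | b, 0 => [b]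
  | [], m + 1 => (insertions x [] m).map (x :: ·)
  | y :: b, m + 1 => (insertions x b (m + 1)).map (y :: ·) ++ (insertions x (y :: b) m).map (x :: ·)
termination_by b m => b.length + m

/-- Insertion inverts deletion: the words with `m` copies of `x` are fibred over the words that
remain when `x` is deleted. -/
theorem mem_insertions {x : α} {b : List α} (hx : x ∉ b) (m : ℕ) (l : List α) :
    l ∈ insertions x b m ↔ l.filter (· ≠ x) = b ∧ l.count x = m := by
  induction b, m using insertions.induct generalizing l with
  | case1 b =>
    simp only [insertions, List.mem_singleton]
    constructor
    · rintro rfl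
      exact ⟨List.filter_eq_self.2 fun a ha => by simpa using fun h : a = x => hx (h ▸ ha),
        List.count_eq_zero.2 hx⟩
    · rintro ⟨rfl, h⟩
      exact (List.filter_eq_self.2 fun a ha => by
        simpa using fun h' : a = x => List.count_eq_zero.1 h (h' ▸ ha)).symm
  | case2 m ih =>
    rw [insertions]
    cases l with
    | nil => simp
    | cons a l =>
      simp only [List.mem_map, List.cons.injEq, List.filter_cons, List.count_cons]
      by_cases h : a = x
      · subst h; simp [ih hx]
      · simp [h, Ne.symm h]
  | case3 y b m ih1 ih2 =>
    rw [insertions]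
    simp only [List.mem_cons, not_or] at hx
    cases l with
    | nil => simp
    | cons a l =>
      simp only [List.mem_append, List.mem_map, List.cons.injEq, List.filter_cons, List.count_cons]
      by_cases h : a = x
      · subst h
        simp [ih2 (by simp [hx]), Ne.symm hx.1]
      · by_cases h' : a = y
        · subst h'; simp [ih1 hx.2, h, Ne.symm h]
        · simp [h, h', Ne.symm h, Ne.symm h']

omit [DecidableEq α] in
theorem nodup_insertions {x : α} {b : List α} (hx : x ∉ b) (m : ℕ) :
    (insertions x b m).Nodup := by
  induction b, m using insertions.induct with
  | case1 b => simp [insertions]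
  | case2 m ih =>
    rw [insertions]
    exact (ih hx).map fun _ _ h => by simpa using h
  | case3 y b m ih1 ih2 =>
    rw [insertions]
    simp only [List.mem_cons, not_or] at hx
    refine List.Nodup.append ((ih1 hx.2).map fun _ _ h => by simpa using h)
      ((ih2 (by simp [hx])).map fun _ _ h => by simpa using h) ?_
    intro l h1 h2
    simp only [List.mem_map] at h1 h2
    obtain ⟨_, _, rfl⟩ := h1
    obtain ⟨_, _, h⟩ := h2
    exact hx.1 (by simpa using (List.cons.inj h).1)

variable (R I : α → α → Prop) [DecidableRel I] (E : α → Prop)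

/-- The word `l` may follow the letter `p`: neighbours are related by `R`, and the last letter
satisfies `E` (if `l` is empty, the proposition `e` holds). -/
def Follows : Prop → α → List α → Prop
  | e, _, [] => e
  | _, p, y :: l => R p y ∧ Follows (E y) y l

/-- The number of pairs of positions of a word whose letters are related by `I`. -/
def pairCount : List α → ℕ
  | [] => 0
  | p :: l => l.countP (fun y => decide (I p y)) + pairCount l

open Classical in
/-- The enumerator of the words obtained from `b` by inserting `m` copies of `x`. -/
noncomputable def insertSum (q : A) (x : α) (e : Prop) (p : α) (b : List α) (m : ℕ) : A :=
  ((insertions x b m).map fun l => if Follows R E e p l then q ^ pairCount I l else 0).sum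

open Classical in
/-- The weights of the admissible gaps of the word `b`, preceded by `p`, for the letter `x`. -/
noncomputable def gapWeights (q : A) (x : α) : α → List α → List A
  | p, [] => if R p x ∧ E x then [1] else []
  | p, y :: b => (if R p x ∧ R x y then [q ^ (y :: b).countP fun y => decide (I x y)] else []) ++
      if I y x then (gapWeights q x y b).map (q * ·) else gapWeights q x y b

variable {R I E}

theorem countP_of_mem_insertions {x : α} {b : List α} (hx : x ∉ b) {m : ℕ} {l : List α}
    (h : l ∈ insertions x b m) (P : α → Prop) [DecidablePred P] :
    l.countP (fun y => decide (P y)) =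
      b.countP (fun y => decide (P y)) + if P x then m else 0 := by
  obtain ⟨rfl, rfl⟩ := (mem_insertions hx m l).1 h
  clear h hx
  induction l with
  | nil => simp
  | cons a l ih =>
    simp only [List.countP_cons, List.filter_cons, List.count_cons, ih]
    by_cases h : a = x
    · subst h; by_cases h' : P a <;> simp [h']; omega
    · by_cases h' : P a <;> by_cases h'' : P x <;> simp [h, h', h'']; omega

-- Peels off the first letter. The number of its pairs depends only on the multiset of letters
-- behind it, so it is the same for all insertions.
open Classical in
theorem insertSum_cons_aux (q : A) {x : α} (e : Prop) (p : α) {y : α} {b : List α}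
    (hx : x ∉ b) (m : ℕ) :
    (((insertions x b m).map (y :: ·)).map
      fun l => if Follows R E e p l then q ^ pairCount I l else 0).sum =
    if R p y then q ^ (b.countP (fun z => decide (I y z)) + if I y x then m else 0) *
      insertSum R I E q x (E y) y b m else 0 := by
  rw [List.map_map]
  by_cases h : R p y
  · rw [if_pos h, insertSum, ← List.sum_map_mul_left]
    congr 1
    refine List.map_congr_left fun l hl => ?_
    simp only [Function.comp, Follows, h, true_and, pairCount, countP_of_mem_insertions hx hl]
    split_ifs <;> ring
  · simp only [Function.comp_def, Follows, h, false_and, if_false]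
    simp

theorem insertSum_cons_zero (q : A) {x : α} (e : Prop) (p : α) {y : α} {b : List α}
    (hx : x ∉ b) : insertSum R I E q x e p (y :: b) 0 =
    open Classical in if R p y then q ^ (b.countP (fun z => decide (I y z))) *
      insertSum R I E q x (E y) y b 0 else 0 := by
  have h := insertSum_cons_aux (R := R) (I := I) (E := E) q e p (y := y) hx 0
  simp only [ite_self, add_zero] at h
  rw [← h]
  simp [insertSum, insertions]

theorem insertSum_cons_succ (q : A) {x : α} (hI : ¬ I x x) (e : Prop) (p : α) {y : α} {b : List α}
    (hx : x ∉ y :: b) (m : ℕ) : insertSum R I E q x e p (y :: b) (m + 1) =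
    (open Classical in
      if R p y then q ^ (b.countP (fun z => decide (I y z)) + if I y x then (m + 1) else 0) *
        insertSum R I E q x (E y) y b (m + 1) else 0) +
    (open Classical in if R p x then q ^ ((y :: b).countP (fun z => decide (I x z))) *
        insertSum R I E q x (E x) x (y :: b) m else 0) := by
  have h1 := insertSum_cons_aux (R := R) (I := I) (E := E) q e p (y := y)
    (List.not_mem_of_not_mem_cons hx) (m + 1)
  have h2 := insertSum_cons_aux (R := R) (I := I) (E := E) q e p (y := x) hx m
  simp only [hI, if_false, add_zero] at h2
  rw [← h1, ← h2, insertSum, insertions, List.map_append, List.sum_append]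

theorem insertSum_nil_succ (q : A) {x : α} (hI : ¬ I x x) (e : Prop) (p : α) (m : ℕ) :
    insertSum R I E q x e p [] (m + 1) =
    open Classical in if R p x then insertSum R I E q x (E x) x [] m else 0 := by
  have h2 := insertSum_cons_aux (R := R) (I := I) (E := E) q e p (y := x) (b := [])
    (List.not_mem_nil (a := x)) m
  simp only [hI, if_false, add_zero, List.countP_nil, pow_zero, one_mul] at h2
  rw [← h2, insertSum, insertions]

open Classical in
/-- If `x` may not follow itself, at most one copy goes into every gap. -/
theorem insertSum_eq_esymmList (q : A) {x : α} (hR : ¬ R x x) (hI : ¬ I x x)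
    {D : α → Prop} (hD : ∀ p y, D p → D y → R p x → R x y → R p y) (hx : ¬ D x)
    (b : List α) (hb : ∀ y ∈ b, D y ∧ (R y x → E x → E y)) (e : Prop) (p : α) (hp : D p)
    (he : R p x → E x → e) (m : ℕ) :
    insertSum R I E q x e p b m =
      if Follows R E e p b then q ^ pairCount I b * esymmList (gapWeights R I E q x p b) m
      else 0 := by
  induction b generalizing e p m with
  | nil =>
    cases m with
    | zero => simp [insertSum, insertions]
    | succ m =>
      rw [insertSum_nil_succ q hI]
      cases m with
      | zero =>
        by_cases h : R p x <;> by_cases h' : E x <;>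
          simp_all [insertSum, insertions, Follows, pairCount, gapWeights, esymmList]
      | succ m =>
        rw [insertSum_nil_succ q hI]
        by_cases h : R p x <;> by_cases h' : E x <;>
          simp_all [Follows, pairCount, gapWeights, esymmList]
  | cons y b ih =>
    have hxb : x ∉ y :: b := fun h => hx (hb x h).1
    have hxb' := List.not_mem_of_not_mem_cons hxb
    have hy := hb y (by simp)
    have ih' := ih (fun z hz => hb z (by simp [hz])) (E y) y hy.1 hy.2
    cases m with
    | zero =>
      rw [insertSum_cons_zero q e p hxb', ih']
      by_cases h : R p y <;> simp [h, Follows, pairCount, pow_add]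
    | succ m =>
      -- Since `x` cannot follow itself, a copy of `x` placed before `y` is followed by `y` at once.
      have hstep : insertSum R I E q x (E x) x (y :: b) m =
          if R x y then q ^ (b.countP (fun z => decide (I y z)) + if I y x then m else 0) *
            insertSum R I E q x (E y) y b m else 0 := by
        cases m with
        | zero => simp [insertSum_cons_zero q (E x) x hxb']
        | succ m => rw [insertSum_cons_succ q hI (E x) x hxb m, if_neg hR, add_zero]
      rw [insertSum_cons_succ q hI e p hxb m, hstep, ih', ih', gapWeights, Follows, pairCount]
      by_cases hF : Follows R E (E y) y b
      · by_cases h1 : R p x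
        · by_cases h2 : R x y
          -- An open gap joins letters that may also be adjacent, so deleting `x` keeps the word
          -- admissible. The two summands then match the recursion of `esymmList`.
          · have h3 := hD p y hp hy.1 h1 h2
            by_cases h4 : I y x <;>
              simp only [h1, h2, h3, h4, hF, if_true, if_false, and_true, List.singleton_append,
                esymmList, esymmList_map_mul] <;> ring
          · by_cases h3 : R p y <;> by_cases h4 : I y x <;>
              simp only [h1, h2, h3, h4, hF, if_true, if_false, and_true, and_false,
                List.nil_append, esymmList_map_mul, mul_zero, add_zero] <;> ring
        · by_cases h3 : R p y <;> by_cases h4 : I y x <;>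
              simp only [h1, h3, h4, hF, if_true, if_false, and_true, false_and,
                List.nil_append, esymmList_map_mul, add_zero] <;> ring
      · simp [hF]

open Classical in
/-- If `x` may follow itself, any number of copies goes into every gap. -/
theorem insertSum_eq_hsymmList (q : A) {x : α} (hR : R x x) (hI : ¬ I x x)
    {D : α → Prop} (hD : ∀ p y, D p → D y → R p x → R x y → R p y)
    (b : List α) (hb : ∀ y ∈ b, D y ∧ y ≠ x ∧ (R y x → E x → E y)) (e : Prop) (p : α)
    (hp : p = x ∨ D p) (he : R p x → E x → e) (m : ℕ) :
    insertSum R I E q x e p b m =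
      if Follows R E e p b then q ^ pairCount I b * hsymmList (gapWeights R I E q x p b) m
      else 0 := by
  induction b generalizing e p m with
  | nil =>
    induction m generalizing e p with
    | zero => simp [insertSum, insertions]
    | succ m ihm =>
      rw [insertSum_nil_succ q hI, ihm (E x) x (Or.inl rfl) fun _ h => h]
      by_cases h : R p x <;> by_cases h' : E x <;>
          simp_all [Follows, pairCount, gapWeights, hsymmList]
  | cons y b ih =>
    have hxb : x ∉ y :: b := fun h => (hb x h).2.1 rfl
    have hxb' := List.not_mem_of_not_mem_cons hxb
    have hy := hb y (by simp)
    have ih' := ih (fun z hz => hb z (by simp [hz])) (E y) y (Or.inr hy.1) hy.2.2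
    induction m generalizing e p with
    | zero =>
      rw [insertSum_cons_zero q e p hxb', ih']
      by_cases h : R p y <;> simp [h, Follows, pairCount, pow_add]
    | succ m ihm =>
      -- After one copy of `x` the same gap is still available; this is why the preceding letter is
      -- allowed to be `x` itself.
      rw [insertSum_cons_succ q hI e p hxb m, ihm (E x) x (Or.inl rfl) fun _ h => h, ih']
      simp only [gapWeights, Follows, pairCount]
      by_cases hF : Follows R E (E y) y b
      · by_cases h1 : R p x
        · by_cases h2 : R x y
          · have h3 : R p y := hp.elim (fun h => h ▸ h2) fun h => hD p y h hy.1 h1 h2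
            by_cases h4 : I y x <;>
              simp only [h1, h2, h3, h4, hR, hF, if_true, if_false, and_true, List.singleton_append,
                hsymmList, hsymmList_map_mul] <;> ring
          · by_cases h3 : R p y <;> by_cases h4 : I y x <;>
              simp only [h1, h2, h3, h4, hF, if_true, if_false, and_true, and_false,
                List.nil_append, hsymmList_map_mul, mul_zero, add_zero] <;> ring
        · by_cases h3 : R p y <;> by_cases h4 : I y x <;>
              simp only [h1, h3, h4, hF, if_true, if_false, and_true, false_and,
                List.nil_append, hsymmList_map_mul, add_zero] <;> ring
      · simp [hF]

variable (R I E)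

open Classical in
/-- The enumerator of the words with a given multiset of letters, the first one following `p`. -/
noncomputable def wordSum (q : A) (p : α) (M : Multiset α) : A :=
  ∑ l ∈ M.lists.toFinset, if Follows R E True p l then q ^ pairCount I l else 0

variable {R I E}

omit [DecidableEq α] in
theorem mem_lists_toFinset [DecidableEq (List α)] (M : Multiset α) (l : List α) :
    l ∈ M.lists.toFinset ↔ (l : Multiset α) = M := by
  rw [Multiset.mem_toFinset, Multiset.mem_lists_iff]
  exact eq_comm

/-- Classify words by the word that remains when a letter `x` is deleted. -/
theorem wordSum_eq_sum_insertSum (q : A) (p : α) (M : Multiset α) (x : α) :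
    wordSum R I E q p M = ∑ b ∈ (M.filter (· ≠ x)).lists.toFinset,
      insertSum R I E q x True p b (M.count x) := by
  classical
  have hx : ∀ b ∈ (M.filter (· ≠ x)).lists.toFinset, x ∉ b := fun b hb h => by
    rw [mem_lists_toFinset] at hb
    have : x ∈ M.filter (· ≠ x) := by rw [← hb]; exact h
    simp at this
  have h : M.lists.toFinset = (M.filter (· ≠ x)).lists.toFinset.biUnion
      fun b => (insertions x b (M.count x)).toFinset := by
    ext l
    simp only [Finset.mem_biUnion, mem_lists_toFinset, List.mem_toFinset]
    constructor
    · rintro rfl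
      refine ⟨l.filter (· ≠ x), by simp, (mem_insertions (by simp) _ _).2 ⟨rfl, by simp⟩⟩
    · rintro ⟨b, hb, hl⟩
      have hxb := hx b ((mem_lists_toFinset _ _).2 hb)
      obtain ⟨h1, h2⟩ := (mem_insertions hxb _ _).1 hl
      ext y
      by_cases hy : y = x
      · subst hy; simpa using h2
      · have := congrArg (Multiset.count y) hb
        rw [Multiset.count_filter_of_pos (p := fun a => a ≠ x) hy, ← h1] at this
        rw [← this, Multiset.coe_count, Multiset.coe_count, List.count_filter (by simpa using hy)]
  rw [wordSum, h, Finset.sum_biUnion]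
  · refine Finset.sum_congr rfl fun b hb => ?_
    rw [insertSum, List.sum_toFinset _ (nodup_insertions (hx b hb) _)]
  · intro b hb b' hb' hne
    rw [Function.onFun, Finset.disjoint_left]
    intro l h1 h2
    rw [List.mem_toFinset] at h1 h2
    rw [mem_insertions (hx _ hb)] at h1
    rw [mem_insertions (hx _ hb')] at h2
    exact hne (h1.1.symm.trans h2.1)

/-- If the gap weights for `x` do not depend on the remaining word, their symmetric function
factors out. -/
theorem wordSum_eq_mul (q : A) (p : α) (M : Multiset α) (x : α) (K : A)
    (h : ∀ b : List α, (b : Multiset α) = M.filter (· ≠ x) →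
      insertSum R I E q x True p b (M.count x) =
        open Classical in if Follows R E True p b then q ^ pairCount I b * K else 0) :
    wordSum R I E q p M = K * wordSum R I E q p (M.filter (· ≠ x)) := by
  rw [wordSum_eq_sum_insertSum q p M x, wordSum, Finset.mul_sum]
  refine Finset.sum_congr rfl fun b hb => ?_
  rw [h b ((mem_lists_toFinset _ _).1 hb)]
  split_ifs <;> ring

end Insertion

/-! ## Arithmetic progressions of gap weights -/

section GapWeights

variable {α A : Type*} [CommSemiring A] {R I : α → α → Prop} [DecidableRel I] {E : α → Prop}

/-- The word starts after a letter that `x` cannot follow and ends in one that `x` can follow. By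
`h3` this change can only happen at a letter that is compatible with `x` on both sides. -/
theorem countP_pos_of_follows (x : α) (b : List α) (h1 : ∀ y ∈ b, I y x ↔ R x y ∧ R y x)
    (e : Prop) (p : α) (he : ¬ e) (h2 : ∀ y ∈ b, E y → E x ∨ R y x) (hE : ¬ E x) (hp : ¬ R p x)
    (h3 : ∀ u ∈ p :: b, ∀ y ∈ b, ¬ R u x → R u y → R x y) (hb : Follows R E e p b) :
    0 < b.countP (fun y => decide (I y x)) := by
  induction b generalizing e p with
  | nil => exact absurd hb he
  | cons y b ih =>
    have hxy : R x y := h3 p (by simp) y (by simp) hp hb.1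
    rw [List.countP_cons]
    by_cases hyx : R y x
    · simp [(h1 y (by simp)).2 ⟨hxy, hyx⟩]
    · exact Nat.lt_of_lt_of_le (ih (fun z hz => h1 z (by simp [hz])) (E y) y
        (fun hy => (h2 y (by simp) hy).elim hE hyx) (fun z hz => h2 z (by simp [hz])) hyx
        (fun u hu z hz => h3 u (by simp [List.mem_cons.1 hu]) z (by simp [hz])) hb.2)
        (Nat.le_add_right _ _)

open Classical in
/-- The gap weights when the inserted letter forms pairs only with letters to its left. -/
theorem gapWeights_eq_of_left (q : A) (x : α) (b : List α)
    (h1 : ∀ y ∈ b, I y x ↔ R x y ∧ R y x) (h2 : ∀ y ∈ b, R x y ∨ R y x) (h3 : ∀ y ∈ b, ¬ I x y)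
    (h4 : ∀ p ∈ b, ∀ y ∈ b, ¬ R p x → R p y → R x y)
    (h6 : ∀ y ∈ b, E y → E x ∨ R y x)
    (e : Prop) (p : α) (hp : ∀ y ∈ b, ¬ R p x → R p y → R x y) (hb : Follows R E e p b) :
    gapWeights R I E q x p b =
      (List.range (b.countP (fun y => decide (I y x)) + (if R p x then 1 else 0) +
        (if E x then 1 else 0) - 1)).map fun j => q ^ (j + if R p x then 0 else 1) := by
  induction b generalizing e p with
  | nil => by_cases h : R p x <;> by_cases h' : E x <;> simp [gapWeights, h, h']
  | cons y b ih =>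
    have ih' := ih (fun z hz => h1 z (by simp [hz])) (fun z hz => h2 z (by simp [hz]))
      (fun z hz => h3 z (by simp [hz]))
      (fun u hu z hz => h4 u (by simp [hu]) z (by simp [hz]))
      (fun z hz => h6 z (by simp [hz])) (E y) y
      (fun z hz => h4 y (by simp) z (by simp [hz])) hb.2
    have hc : (y :: b).countP (fun z => decide (I x z)) = 0 :=
      List.countP_eq_zero.2 fun z hz => by simpa using h3 z hz
    have h5 : ¬ R p x → R x y := fun h => hp y (by simp) h hb.1
    have h1y := h1 y (by simp)
    have h2y := h2 y (by simp)
    rw [gapWeights, hc, ih', List.countP_cons]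
    -- There are three kinds of letters: two-sided ones (`I y x`), those `x` cannot follow, and
    -- those that cannot follow `x`. By `h4` the second kind is never directly followed by the
    -- third. Hence exactly one gap is open between consecutive two-sided letters, one before the
    -- first of them iff `R p x`, and one after the last iff `E x`; each two-sided letter passed
    -- multiplies the weight by `q`.
    by_cases hI : I y x
    · obtain ⟨h8, h7⟩ := h1y.1 hI
      by_cases h : R p x <;> by_cases hE : E x <;>
        simp [h, h8, h7, hI, hE, List.range_succ_eq_map, pow_succ', Function.comp_def]
    · by_cases h7 : R y x
      · have h8 : ¬ R x y := fun h => hI (h1y.2 ⟨h, h7⟩)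
        have h : R p x := by_contra fun h => h8 (h5 h)
        simp [h, h8, h7, hI]
      · have h8 : R x y := h2y.resolve_right h7
        by_cases h : R p x <;> by_cases hE : E x
        · simp [h, h8, h7, hI, hE, List.range_succ_eq_map]
        -- Here the tail contains a two-sided letter, so the subtraction of `1` in the count is not
        -- truncated.
        · obtain ⟨n, hn⟩ := Nat.exists_eq_succ_of_ne_zero (countP_pos_of_follows x b
            (fun z hz => h1 z (by simp [hz])) (E y) y
            (fun hy => (h6 y (by simp) hy).elim hE h7)
            (fun z hz => h6 z (by simp [hz])) hE h7
            (fun u hu z hz => h4 u (by simpa using hu) z (by simp [hz])) hb.2).ne'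
          simp [h, h8, h7, hI, hE, hn, List.range_succ_eq_map]
        · simp [h, h8, h7, hI, hE]
        · simp [h, h8, h7, hI, hE]

open Classical in
/-- The gap weights when the inserted letter forms pairs only with letters to its right. -/
theorem gapWeights_eq_of_right (q : A) (x : α) (b : List α) (hE : E x)
    (h1 : ∀ y ∈ b, I x y ↔ R y x) (h2 : ∀ y ∈ b, R x y) (h3 : ∀ y ∈ b, ¬ I y x) (p : α) :
    gapWeights R I E q x p b =
      (List.range (b.countP (fun y => decide (I x y)) + if R p x then 1 else 0)).reverse.map
        fun j => q ^ j := by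
  induction b generalizing p with
  | nil => by_cases h : R p x <;> simp [gapWeights, h, hE]
  | cons y b ih =>
    have ih' := ih (fun z hz => h1 z (by simp [hz])) (fun z hz => h2 z (by simp [hz]))
      (fun z hz => h3 z (by simp [hz])) y
    have h1y := h1 y (by simp)
    -- Every letter may follow `x`, so a gap is open iff `x` may follow the letter before it. Those
    -- letters are also the ones `x` pairs with, so the exponents descend one by one to `0`.
    rw [gapWeights, ih', List.countP_cons, if_neg (h3 y (by simp))]
    by_cases h : R p x <;> by_cases hI : R y x <;>
      simp [h, h1y, hI, h2 y, List.range_succ]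

/-! ### q-analogues and symmetric polynomials of 1, q, ..., q^(W-1) -/

/-- The `q`-analogue of a natural number. -/
def qNat (q : A) (n : ℕ) : A := ∑ i ∈ Finset.range n, q ^ i

theorem qNat_add (q : A) (m n : ℕ) : qNat q (m + n) = qNat q m + q ^ m * qNat q n := by
  simp [qNat, Finset.sum_range_add, Finset.mul_sum, pow_add]

@[simp] theorem qNat_zero (q : A) : qNat q 0 = 0 := by simp [qNat]

/-- The rising factorial `[a]_q [a+1]_q ⋯ [a+m-1]_q`. -/
def qRising (q : A) (a m : ℕ) : A := ∏ j ∈ Finset.range m, qNat q (a + j)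

@[simp] theorem qRising_zero (q : A) (a : ℕ) : qRising q a 0 = 1 := by simp [qRising]

theorem qRising_succ (q : A) (a m : ℕ) :
    qRising q a (m + 1) = qRising q a m * qNat q (a + m) := by
  simp [qRising, Finset.prod_range_succ]

theorem qRising_succ' (q : A) (a m : ℕ) :
    qRising q a (m + 1) = qNat q a * qRising q (a + 1) m := by
  rw [qRising, Finset.prod_range_succ', mul_comm]
  simp [qRising, add_assoc, add_comm 1]

theorem qRising_add (q : A) (a m n : ℕ) :
    qRising q a (m + n) = qRising q a m * qRising q (a + m) n := by
  simp [qRising, Finset.prod_range_add, add_assoc]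

theorem range_succ_map_pow (q : A) (W : ℕ) :
    (List.range (W + 1)).map (fun j => q ^ j) =
      1 :: ((List.range W).map (fun j => q ^ j)).map (q * ·) := by
  simp [List.range_succ_eq_map, pow_succ', Function.comp_def]

/-- The value is a Gaussian binomial; the denominator [m]! is cleared because `A` is only a
semiring. -/
theorem hsymmList_range (q : A) (W m : ℕ) :
    hsymmList ((List.range W).map fun j => q ^ j) m * qRising q 1 m = qRising q W m := by
  induction W generalizing m with
  | zero => cases m <;> simp [hsymmList, qRising_succ']
  | succ W ih =>
    induction m with
    | zero => simp
    | succ m ihm =>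
      have h := ih (m + 1)
      rw [range_succ_map_pow] at ihm ⊢
      rw [hsymmList, hsymmList_map_mul, add_mul, mul_assoc, h, one_mul,
        qRising_succ q 1, ← mul_assoc, ihm, qRising_succ', qRising_succ,
        show W + 1 + m = (1 + m) + W by ring, qNat_add q (1 + m)]
      ring

/-- The recursion now peels off `q ^ W` instead of `1`, so [W + 1 + m] is split in the other order.
-/
theorem hsymmList_range_reverse (q : A) (W m : ℕ) :
    hsymmList ((List.range W).reverse.map fun j => q ^ j) m * qRising q 1 m = qRising q W m := by
  induction W generalizing m with
  | zero => cases m <;> simp [hsymmList, qRising_succ']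
  | succ W ih =>
    induction m with
    | zero => simp
    | succ m ihm =>
      have h := ih (m + 1)
      rw [List.range_succ, List.reverse_concat, List.map_cons] at ihm ⊢
      rw [hsymmList, add_mul, h, qRising_succ q 1, mul_assoc, ← mul_assoc _ (qRising q 1 m), ihm,
        qRising_succ', qRising_succ, show W + 1 + m = W + (1 + m) by ring,
        qNat_add q W (1 + m)]
      ring

theorem esymmList_range (q : A) (W k : ℕ) :
    esymmList ((List.range W).map fun j => q ^ j) k * qRising q 1 k =
      ∏ j ∈ Finset.range k, q ^ j * qNat q (W - j) := by
  induction W generalizing k with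
  | zero => cases k <;> simp [esymmList]
  | succ W ih =>
    cases k with
    | zero => simp
    | succ k =>
      have h := ih (k + 1)
      have h' := ih k
      rw [range_succ_map_pow, esymmList, esymmList_map_mul, esymmList_map_mul, add_mul, mul_assoc,
        h, qRising_succ, one_mul, mul_assoc, ← mul_assoc _ (qRising q 1 k), h',
        Finset.prod_range_succ, Finset.prod_range_succ']
      simp only [Nat.add_sub_add_right, pow_succ, mul_right_comm _ q, Finset.prod_mul_distrib,
        Finset.prod_const, Finset.card_range]
      rcases le_or_gt k W with hk | hk
      · have : qNat q (W + 1) = qNat q (1 + k) + q ^ (1 + k) * qNat q (W - k) := by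
          rw [← qNat_add]; congr 1; omega
        simp only [Nat.sub_zero, this]
        ring
      -- For `k > W` the factor with `j = W` is [0], so the truncated differences beyond it do no
      -- harm.
      · have : ∏ j ∈ Finset.range k, qNat q (W - j) = 0 :=
          Finset.prod_eq_zero (Finset.mem_range.2 hk) (by simp)
        simp [this]

end GapWeights

/-- After multiplication by [k]!, both sides are the same power of q times [W][W-1]...[W-k]. -/
theorem qNat_mul_esymmList_range {K : Type*} [Field K] (q : K) (hq : ∀ n, qNat q (n + 1) ≠ 0)
    (W k : ℕ) :
    qNat q W * esymmList ((List.range (W - 1)).map fun j => q ^ j) k =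
      qNat q (W - k) * esymmList ((List.range W).map fun j => q ^ j) k := by
  have h : qRising q 1 k ≠ 0 := Finset.prod_ne_zero_iff.2 fun j _ => by rw [add_comm]; exact hq j
  refine mul_right_cancel₀ h ?_
  rw [mul_assoc, mul_assoc, esymmList_range, esymmList_range, Finset.prod_mul_distrib,
    Finset.prod_mul_distrib, mul_left_comm, mul_left_comm (qNat q (W - k))]
  congr 1
  have h1 := Finset.prod_range_succ (fun j => qNat q (W - j)) k
  have h2 := Finset.prod_range_succ' (fun j => qNat q (W - j)) k
  simp only [Nat.sub_zero] at h2
  rw [mul_comm (qNat q (W - k)), ← h1, h2, mul_comm]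
  simp only [Nat.sub_sub, add_comm 1]

theorem esymmList_range_eq_zero {K : Type*} [Field K] (q : K) (hq : ∀ n, qNat q (n + 1) ≠ 0)
    {W k : ℕ} (h : W < k) : esymmList ((List.range W).map fun j => q ^ j) k = 0 := by
  have h' : qRising q 1 k ≠ 0 := Finset.prod_ne_zero_iff.2 fun j _ => by rw [add_comm]; exact hq j
  refine (mul_eq_zero.1 ?_).resolve_right h'
  rw [esymmList_range]
  exact Finset.prod_eq_zero (Finset.mem_range.2 h) (by simp)

/-! ## Rows of labelled paths -/

/-- A row of a labelled path: its diagonal, its label, and whether it is decorated. -/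
abbrev Row := ℤ × ℕ × Bool

/-- The row `y` may directly follow the row `p`. -/
def RowAdj (p y : Row) : Prop :=
  y.1 ≤ p.1 + 1 ∧ (y.1 = p.1 + 1 → p.2.1 < y.2.1 ∧ y.2.2 = false) ∧
    (y.1 = p.1 → y.2.2 = true → p.2.1 < y.2.1)

/-- The rows `p` and `y`, in this order, form an inversion, and `p` is not decorated. -/
def RowInv (p y : Row) : Prop :=
  p.2.2 = false ∧ ((p.1 = y.1 ∧ p.2.1 < y.2.1) ∨ (p.1 = y.1 + 1 ∧ y.2.1 < p.2.1))

instance : DecidableRel RowAdj := fun _ _ => inferInstanceAs (Decidable (_ ∧ _))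

instance : DecidableRel RowInv := fun _ _ => inferInstanceAs (Decidable (_ ∧ _))

/-- A virtual row preceding the first row of a path of shift `s`. -/
def startRow (s : ℤ) : Row := (s - 1, 0, false)

/-- The enumerator by inversions of the words of rows of paths of shift `s`. -/
noncomputable def rowSum (s : ℤ) (M : Multiset Row) : QT :=
  wordSum RowAdj RowInv (fun y => s ≤ y.1) q (startRow s) M

theorem countP_filter_ne (M : Multiset Row) (x : Row) (P : Row → Prop) [DecidablePred P]
    (h : ¬ P x) : (M.filter (· ≠ x)).countP P = M.countP P := by
  rw [Multiset.countP_filter]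
  refine Multiset.countP_congr rfl fun y _ => ?_
  simp only [eq_iff_iff, and_iff_left_iff_imp]
  rintro h' rfl
  exact h h'

theorem startRow_adj_decorated_iff (s i : ℤ) (c : ℕ) :
    RowAdj (startRow s) (i, c, true) ↔ i < s - 1 ∨ i = s - 1 ∧ 0 < c := by
  simp only [RowAdj, startRow]
  grind

/-- Removing all copies of a decorated row. -/
theorem rowSum_eq_of_decorated (s i : ℤ) (c : ℕ) (M : Multiset Row) :
    rowSum s M =
      esymmList ((List.range (M.countP (RowInv · (i, c, true)) +
        (if i < s - 1 ∨ i = s - 1 ∧ 0 < c then 1 else 0) + (if s ≤ i then 1 else 0) - 1)).map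
          fun j => q ^ (j + if i < s - 1 ∨ i = s - 1 ∧ 0 < c then 0 else 1))
        (M.count (i, c, true)) * rowSum s (M.filter (· ≠ (i, c, true))) := by
  refine wordSum_eq_mul q _ M (i, c, true) _ fun b hb => ?_
  have hy : ∀ y ∈ b, y ≠ (i, c, true) := fun y h => by
    have : y ∈ M.filter (· ≠ (i, c, true)) := by rw [← hb]; exact h
    simpa using (Multiset.mem_filter.1 this).2
  have hM : b.countP (fun y => decide (RowInv y (i, c, true))) =
      M.countP (RowInv · (i, c, true)) := by
    rw [← countP_filter_ne M (i, c, true) _ (by simp [RowInv]), ← hb, Multiset.coe_countP]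
  rw [insertSum_eq_esymmList q (D := fun y => y ≠ (i, c, true)) (by simp [RowAdj])
    (by simp [RowInv]) _ (by simp) b _ True _ (by simp [startRow]) (by simp)]
  · by_cases hF : Follows RowAdj (fun y => s ≤ y.1) True (startRow s) b
    · rw [if_pos hF, if_pos hF, gapWeights_eq_of_left q _ b _ _ _ _ _ True (startRow s) _ hF, hM]
      · simp only [startRow_adj_decorated_iff]
        congr!
      -- The two-sided rows for a decorated `x` are exactly the undecorated rows that form an
      -- inversion with `x` when they stand on its left.
      · rintro ⟨y1, y2, y3⟩ h
        have := hy _ h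
        simp only [RowAdj, RowInv]
        grind
      · rintro ⟨y1, y2, y3⟩ h
        have := hy _ h
        simp only [RowAdj]
        grind
      · rintro ⟨y1, y2, y3⟩ h
        simp [RowInv]
      · rintro ⟨p1, p2, p3⟩ - ⟨y1, y2, y3⟩ -
        simp only [RowAdj]
        grind
      · rintro ⟨y1, y2, y3⟩ -
        simp only [RowAdj]
        grind
      · rintro ⟨y1, y2, y3⟩ -
        simp only [RowAdj, startRow]
        grind
    · rw [if_neg hF, if_neg hF]
  · rintro ⟨p1, p2, p3⟩ ⟨y1, y2, y3⟩ - hy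
    simp only [RowAdj]
    grind
  · intro y h
    refine ⟨hy y h, ?_⟩
    simp only [RowAdj]
    grind

/-- Removing all copies of the smallest row on the top diagonal, if no row is decorated. -/
theorem rowSum_mul_eq_of_top (s i : ℤ) (c : ℕ) (M : Multiset Row) (hi : s ≤ i)
    (h : ∀ y ∈ M, y ≠ (i, c, false) → y.2.2 = false ∧ (y.1 < i ∨ y.1 = i ∧ c < y.2.1) ∧
      (i = s → s ≤ y.1)) :
    rowSum s M * qRising q 1 (M.count (i, c, false)) =
      qRising q (M.countP (RowInv (i, c, false)) + if i = s ∧ 0 < c then 1 else 0)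
        (M.count (i, c, false)) * rowSum s (M.filter (· ≠ (i, c, false))) := by
  rw [rowSum, wordSum_eq_mul q (startRow s) M (i, c, false)
    (hsymmList ((List.range (M.countP (RowInv (i, c, false)) +
      if i = s ∧ 0 < c then 1 else 0)).reverse.map fun j => q ^ j)
      (M.count (i, c, false))), mul_right_comm, hsymmList_range_reverse, rowSum]
  intro b hb
  have hy : ∀ y ∈ b, y ≠ (i, c, false) ∧ y.2.2 = false ∧ (y.1 < i ∨ y.1 = i ∧ c < y.2.1) ∧
      (i = s → s ≤ y.1) := fun y hy => by
    have : y ∈ M.filter (· ≠ (i, c, false)) := by rw [← hb]; exact hy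
    obtain ⟨h1, h2⟩ := Multiset.mem_filter.1 this
    exact ⟨h2, h y h1 h2⟩
  have hM : b.countP (fun y => decide (RowInv (i, c, false) y)) =
      M.countP (RowInv (i, c, false)) := by
    rw [← countP_filter_ne M (i, c, false) _ (by simp [RowInv]), ← hb, Multiset.coe_countP]
  -- The gap in front of the whole word is open only for a positive label on the main diagonal, that
  -- is, at level `s`.
  have hS : RowAdj (startRow s) (i, c, false) ↔ i = s ∧ 0 < c := by
    simp only [RowAdj, startRow]
    grind
  rw [insertSum_eq_hsymmList q
    (D := fun y => y.2.2 = false ∧ (y.1 < i ∨ y.1 = i ∧ c < y.2.1)) (by simp [RowAdj])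
    (by simp [RowInv]) _ b _ True _ (Or.inr (by simp [startRow]; omega)) (by simp),
    gapWeights_eq_of_right q _ b hi, hM]
  · simp only [hS]
  · rintro ⟨y1, y2, y3⟩ h
    have := hy _ h
    simp only [RowAdj, RowInv]
    grind
  · rintro ⟨y1, y2, y3⟩ h
    have := hy _ h
    simp only [RowAdj]
    grind
  · rintro ⟨y1, y2, y3⟩ h
    have := hy _ h
    simp only [RowInv]
    grind
  · rintro ⟨p1, p2, p3⟩ ⟨y1, y2, y3⟩
    simp only [RowAdj]
    grind
  · rintro ⟨y1, y2, y3⟩ h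
    have := hy _ h
    simp only [RowAdj]
    grind

/-- Removing all copies of the largest row on the bottom diagonal, if no row is decorated. -/
theorem rowSum_mul_eq_of_bottom (s i : ℤ) (c : ℕ) (M : Multiset Row) (hi : i < s)
    (h : ∀ y ∈ M, y ≠ (i, c, false) → y.2.2 = false ∧ (i < y.1 ∨ y.1 = i ∧ y.2.1 < c)) :
    rowSum s M * qRising q 1 (M.count (i, c, false)) =
      qRising q (M.countP (RowInv · (i, c, false))) (M.count (i, c, false)) *
        rowSum s (M.filter (· ≠ (i, c, false))) := by
  rw [rowSum, wordSum_eq_mul q (startRow s) M (i, c, false)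
    (hsymmList ((List.range (M.countP (RowInv · (i, c, false)))).map fun j => q ^ j)
      (M.count (i, c, false))), mul_right_comm, hsymmList_range, rowSum]
  intro b hb
  have hy : ∀ y ∈ b, y ≠ (i, c, false) ∧ y.2.2 = false ∧ (i < y.1 ∨ y.1 = i ∧ y.2.1 < c) :=
    fun y hy => by
    have : y ∈ M.filter (· ≠ (i, c, false)) := by rw [← hb]; exact hy
    obtain ⟨h1, h2⟩ := Multiset.mem_filter.1 this
    exact ⟨h2, h y h1 h2⟩
  have hM : b.countP (fun y => decide (RowInv y (i, c, false))) =
      M.countP (RowInv · (i, c, false)) := by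
    rw [← countP_filter_ne M (i, c, false) _ (by simp [RowInv]), ← hb, Multiset.coe_countP]
  have hS : RowAdj (startRow s) (i, c, false) := by
    simp only [RowAdj, startRow]
    grind
  rw [insertSum_eq_hsymmList q
    (D := fun y => i ≤ y.1 ∧ (y.1 = i → y.2.1 ≤ c) ∧ y.2.2 = false) (by simp [RowAdj])
    (by simp [RowInv]) _ b _ True _ (Or.inr (by simp [startRow]; omega)) (by simp)]
  · by_cases hF : Follows RowAdj (fun y => s ≤ y.1) True (startRow s) b
    · rw [if_pos hF, if_pos hF, gapWeights_eq_of_left q _ b _ _ _ _ _ True (startRow s) _ hF, hM]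
      -- The initial gap is open and the final one closed, as `i < s`: the count is W + 1 + 0 - 1.
      · simp [hS, hi.not_ge]
      · rintro ⟨y1, y2, y3⟩ h
        have := hy _ h
        simp only [RowAdj, RowInv]
        grind
      · rintro ⟨y1, y2, y3⟩ h
        have := hy _ h
        simp only [RowAdj]
        grind
      · rintro ⟨y1, y2, y3⟩ h
        have := hy _ h
        simp only [RowInv]
        grind
      · rintro ⟨p1, p2, p3⟩ hp ⟨y1, y2, y3⟩ - hn
        have := hy _ hp
        exact absurd (by simp only [RowAdj]; grind) hn
      · rintro ⟨y1, y2, y3⟩ h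
        simp only [RowAdj]
        grind
      · exact fun _ _ h => absurd hS h
    · rw [if_neg hF, if_neg hF]
  · rintro ⟨p1, p2, p3⟩ ⟨y1, y2, y3⟩
    simp only [RowAdj]
    grind
  · rintro ⟨y1, y2, y3⟩ h
    have := hy _ h
    refine ⟨by grind, this.1, ?_⟩
    simp only [RowAdj]
    grind

theorem qNat_ne_zero (n : ℕ) : qNat q (n + 1) ≠ 0 := by
  have h : qNat q (n + 1) = algebraMap (MvPolynomial (Fin 2) ℚ) QT
      (∑ i ∈ Finset.range (n + 1), MvPolynomial.X 0 ^ i) := by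
    simp [qNat, q]
  rw [h, Ne, FaithfulSMul.algebraMap_eq_zero_iff]
  intro h0
  have := congrArg (MvPolynomial.eval fun _ => (1 : ℚ)) h0
  simp only [map_sum, map_pow, MvPolynomial.eval_X, one_pow, Finset.sum_const, Finset.card_range,
    map_zero, nsmul_eq_mul, mul_one] at this
  exact absurd this (by positivity)

theorem qRising_one_ne_zero (m : ℕ) : qRising q 1 m ≠ 0 :=
  Finset.prod_ne_zero_iff.2 fun j _ => by rw [add_comm]; exact qNat_ne_zero j

/-! ## Climbing from one diagonal to the next -/

/-- Levels rise by at most one per row, so every level in between is crossed by a single rise;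
`RowAdj` then forces a larger, undecorated label. -/
theorem exists_climb {E : Row → Prop} {e : Prop} {p : Row} {l : List Row}
    (h : Follows RowAdj E e p l) {i : ℤ} (hp : p.1 ≤ i) {y : Row} (hy : y ∈ l) (hi : i < y.1) :
    ∃ u ∈ p :: l, ∃ v ∈ l, u.1 = i ∧ v.1 = i + 1 ∧ u.2.1 < v.2.1 ∧ v.2.2 = false := by
  induction l generalizing e p with
  | nil => simp at hy
  | cons x l ih =>
    obtain ⟨⟨h1, h2, -⟩, h4⟩ := h
    by_cases hx : i < x.1
    · have h5 : x.1 = p.1 + 1 := by omega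
      exact ⟨p, by simp, x, by simp, by omega, by omega, h2 h5⟩
    · have hyl : y ∈ l := (List.mem_cons.1 hy).resolve_left fun h => hx (h ▸ hi)
      obtain ⟨u, hu, v, hv, h5⟩ := ih h4 (not_lt.1 hx) hyl
      exact ⟨u, List.mem_cons_of_mem _ hu, v, List.mem_cons_of_mem _ hv, h5⟩

theorem exists_le_of_follows {s : ℤ} {e : Prop} {p : Row} {l : List Row}
    (h : Follows RowAdj (fun y => s ≤ y.1) e p l) (hl : l ≠ []) : ∃ y ∈ l, s ≤ y.1 := by
  induction l generalizing e p with
  | nil => exact absurd rfl hl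
  | cons x l ih =>
    rcases eq_or_ne l [] with rfl | hl'
    · exact ⟨x, by simp, h.2⟩
    · obtain ⟨y, hy, h'⟩ := ih h.2 hl'
      exact ⟨y, List.mem_cons_of_mem _ hy, h'⟩

/-- The last row has level at least `s`, so a word with a row at level at most `i < s` has to climb
back. The lower row `u` lies in the word itself and is not the virtual row. -/
theorem exists_climb_of_lt {s : ℤ} {e : Prop} {p : Row} {l : List Row}
    (h : Follows RowAdj (fun y => s ≤ y.1) e p l) {i : ℤ} (hi : i < s) {x : Row} (hx : x ∈ l)
    (hxi : x.1 ≤ i) :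
    ∃ u ∈ l, ∃ v ∈ l, u.1 = i ∧ v.1 = i + 1 ∧ u.2.1 < v.2.1 ∧ v.2.2 = false := by
  induction l generalizing e p with
  | nil => simp at hx
  | cons y l ih =>
    rcases List.mem_cons.1 hx with rfl | hx
    · have hl : l ≠ [] := by
        rintro rfl
        have : s ≤ x.1 := h.2
        omega
      obtain ⟨y, hy, hsy⟩ := exists_le_of_follows h.2 hl
      obtain ⟨u, hu, v, hv, h5⟩ := exists_climb h.2 hxi hy (by omega)
      exact ⟨u, hu, v, List.mem_cons_of_mem _ hv, h5⟩
    · obtain ⟨u, hu, v, hv, h5⟩ := ih h.2 hx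
      exact ⟨u, List.mem_cons_of_mem _ hu, v, List.mem_cons_of_mem _ hv, h5⟩

theorem exists_follows_of_rowSum_ne_zero {s : ℤ} {M : Multiset Row} (h : rowSum s M ≠ 0) :
    ∃ l : List Row, (l : Multiset Row) = M ∧
      Follows RowAdj (fun y => s ≤ y.1) True (startRow s) l := by
  obtain ⟨l, hl, h'⟩ := Finset.exists_ne_zero_of_sum_ne_zero h
  exact ⟨l, (mem_lists_toFinset _ _).1 hl, by_contra fun hn => h' (if_neg hn)⟩

theorem exists_climb_below {s : ℤ} {M : Multiset Row} (h : rowSum s M ≠ 0) {i : ℤ} (hi : i < s)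
    {x : Row} (hx : x ∈ M) (hxi : x.1 ≤ i) :
    ∃ u ∈ M, ∃ v ∈ M, u.1 = i ∧ v.1 = i + 1 ∧ u.2.1 < v.2.1 ∧ v.2.2 = false := by
  obtain ⟨l, rfl, hl⟩ := exists_follows_of_rowSum_ne_zero h
  exact exists_climb_of_lt hl hi hx hxi

theorem exists_climb_above {s : ℤ} {M : Multiset Row} (h : rowSum s M ≠ 0) {i : ℤ}
    (hi : s - 1 ≤ i) {y : Row} (hy : y ∈ M) (hyi : i < y.1) :
    ∃ u, (u = startRow s ∨ u ∈ M) ∧ ∃ v ∈ M,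
      u.1 = i ∧ v.1 = i + 1 ∧ u.2.1 < v.2.1 ∧ v.2.2 = false := by
  obtain ⟨l, rfl, hl⟩ := exists_follows_of_rowSum_ne_zero h
  obtain ⟨u, hu, h'⟩ := exists_climb hl hi hy hyi
  exact ⟨u, by simpa using hu, h'⟩

/-! ## Two adjacent diagonals -/

/-- The number of undecorated positive labels on the `i`-th diagonal. -/
def posCount (M : Multiset Row) (i : ℤ) : ℕ :=
  M.countP fun y => y.1 = i ∧ 0 < y.2.1 ∧ y.2.2 = false

theorem posCount_pos_of_mem {M : Multiset Row} {u v : Row} {i : ℤ} (hv : v ∈ M) (h : v.1 = i)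
    (h' : u.2.1 < v.2.1 ∧ v.2.2 = false) : 0 < posCount M i :=
  Multiset.countP_pos.2 ⟨v, hv, h, by omega, h'.2⟩

theorem rowSum_zero (s : ℤ) : rowSum s 0 = 1 := by
  simp [rowSum, wordSum, Follows, pairCount, ← Multiset.coe_nil, Multiset.lists_coe]

/-- Since [L + k - 1]! = [L - 1]! [L]...[L+k-1], the relation `h` passes the factorial from `c` to
`c + 1`. Positivity of `L c` makes [L c - 1]! meaningful. -/
theorem prod_qRising_telescope {A : Type*} [CommSemiring A] (q : A) (L m n : ℕ → ℕ) (C : ℕ)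
    (hL : ∀ c < C, 0 < L c) (h : ∀ c, L (c + 1) + m (c + 1) = L c + n c) :
    (∏ c ∈ Finset.range C, qRising q (L c) (n c)) * qRising q 1 (L 0 + m 0 - 1) =
      (∏ c ∈ Finset.range C, qRising q (L c) (m c)) * qRising q 1 (L C + m C - 1) := by
  induction C with
  | zero => simp
  | succ C ih =>
    have hC := hL C (by simp)
    have key : ∀ k, qRising q 1 (L C + k - 1) = qRising q 1 (L C - 1) * qRising q (L C) k := by
      intro k
      rw [show L C + k - 1 = L C - 1 + k by omega, qRising_add, show 1 + (L C - 1) = L C by omega]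
    rw [Finset.prod_range_succ, Finset.prod_range_succ, mul_right_comm,
      ih fun c hc => hL c (by omega), h, key, key]
    ring

section TwoDiagonals

variable {s : ℤ} {M : Multiset Row}

/-- The upper diagonal is emptied from the smallest label on, so the rows inverting with label `c`
are the larger labels still above and the smaller ones below. -/
theorem rowSum_strip_top (hM : ∀ y ∈ M, (y.1 = s ∨ y.1 = s + 1) ∧ y.2.2 = false) (C : ℕ) :
    rowSum s M * ∏ c ∈ Finset.range C, qRising q 1 (M.count (s + 1, c, false)) =
      (∏ c ∈ Finset.range C, qRising q
        (M.countP fun y => y.1 = s ∧ y.2.1 < c ∨ y.1 = s + 1 ∧ c < y.2.1)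
        (M.count (s + 1, c, false))) * rowSum s (M.filter fun y => y.1 = s ∨ C ≤ y.2.1) := by
  induction C with
  | zero => simp
  | succ C ih =>
    have h := rowSum_mul_eq_of_top s (s + 1) C (M.filter fun y => y.1 = s ∨ C ≤ y.2.1) (by omega)
      (by
        rintro ⟨y1, y2, y3⟩ hy hne
        obtain ⟨h1, h2⟩ := Multiset.mem_filter.1 hy
        have := hM _ h1
        grind)
    have h1 : (M.filter fun y => y.1 = s ∨ C ≤ y.2.1).count (s + 1, C, false) =
        M.count (s + 1, C, false) := Multiset.count_filter_of_pos (Or.inr le_rfl)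
    have h2 : (M.filter fun y => y.1 = s ∨ C ≤ y.2.1).countP (RowInv (s + 1, C, false)) =
        M.countP fun y => y.1 = s ∧ y.2.1 < C ∨ y.1 = s + 1 ∧ C < y.2.1 := by
      rw [Multiset.countP_filter]
      refine Multiset.countP_congr rfl fun y hy => ?_
      have := hM _ hy
      simp only [RowInv]
      grind
    have h3 : (M.filter fun y => y.1 = s ∨ C ≤ y.2.1).filter (· ≠ (s + 1, C, false)) =
        M.filter fun y => y.1 = s ∨ C + 1 ≤ y.2.1 := by
      rw [Multiset.filter_filter]
      refine Multiset.filter_congr fun y hy => ?_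
      have := hM _ hy
      obtain ⟨y1, y2, y3⟩ := y
      grind
    rw [h1, h2, h3, if_neg (by omega), add_zero] at h
    rw [Finset.prod_range_succ, Finset.prod_range_succ, ← mul_assoc, ih, mul_assoc, h]
    ring

/-- The lower diagonal is emptied from the largest label down. The bases of the rising factorials
coincide with those in `rowSum_strip_top`; only their lengths differ. -/
theorem rowSum_strip_bottom (hM : ∀ y ∈ M, (y.1 = s ∨ y.1 = s + 1) ∧ y.2.2 = false) (C : ℕ) :
    rowSum (s + 1) (M.filter fun y => y.1 = s + 1 ∨ y.2.1 < C) *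
        ∏ c ∈ Finset.range C, qRising q 1 (M.count (s, c, false)) =
      (∏ c ∈ Finset.range C, qRising q
        (M.countP fun y => y.1 = s ∧ y.2.1 < c ∨ y.1 = s + 1 ∧ c < y.2.1)
        (M.count (s, c, false))) * rowSum (s + 1) (M.filter fun y => y.1 = s + 1) := by
  induction C with
  | zero => simp
  | succ C ih =>
    have h := rowSum_mul_eq_of_bottom (s + 1) s C
      (M.filter fun y => y.1 = s + 1 ∨ y.2.1 < C + 1) (by omega)
      (by
        rintro ⟨y1, y2, y3⟩ hy hne
        obtain ⟨h1, h2⟩ := Multiset.mem_filter.1 hy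
        have := hM _ h1
        grind)
    have h1 : (M.filter fun y => y.1 = s + 1 ∨ y.2.1 < C + 1).count (s, C, false) =
        M.count (s, C, false) := Multiset.count_filter_of_pos (Or.inr (Nat.lt_succ_self C))
    have h2 : (M.filter fun y => y.1 = s + 1 ∨ y.2.1 < C + 1).countP (RowInv · (s, C, false)) =
        M.countP fun y => y.1 = s ∧ y.2.1 < C ∨ y.1 = s + 1 ∧ C < y.2.1 := by
      rw [Multiset.countP_filter]
      refine Multiset.countP_congr rfl fun y hy => ?_
      have := hM _ hy
      simp only [RowInv]
      grind
    have h3 : (M.filter fun y => y.1 = s + 1 ∨ y.2.1 < C + 1).filter (· ≠ (s, C, false)) =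
        M.filter fun y => y.1 = s + 1 ∨ y.2.1 < C := by
      rw [Multiset.filter_filter]
      refine Multiset.filter_congr fun y hy => ?_
      have := hM _ hy
      obtain ⟨y1, y2, y3⟩ := y
      grind
    rw [h1, h2, h3] at h
    rw [Finset.prod_range_succ, Finset.prod_range_succ, mul_comm (∏ c ∈ _, _), ← mul_assoc, h,
      mul_assoc, ih]
    ring

theorem rowSum_strip_base (hM : ∀ y ∈ M, y.1 = s ∧ y.2.2 = false) (C : ℕ) :
    rowSum s M * ∏ c ∈ Finset.range C, qRising q 1 (M.count (s, c, false)) =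
      (∏ c ∈ Finset.range C, qRising q
        ((M.countP fun y => c + 1 ≤ y.2.1) + if 0 < c then 1 else 0)
        (M.count (s, c, false))) * rowSum s (M.filter fun y => C ≤ y.2.1) := by
  induction C with
  | zero => simp
  | succ C ih =>
    have h := rowSum_mul_eq_of_top s s C (M.filter fun y => C ≤ y.2.1) le_rfl
      (by
        rintro ⟨y1, y2, y3⟩ hy hne
        obtain ⟨h1, h2⟩ := Multiset.mem_filter.1 hy
        have := hM _ h1
        grind)
    have h1 : (M.filter fun y => C ≤ y.2.1).count (s, C, false) =
        M.count (s, C, false) := Multiset.count_filter_of_pos (le_refl C)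
    have h2 : (M.filter fun y => C ≤ y.2.1).countP (RowInv (s, C, false)) =
        M.countP fun y => C + 1 ≤ y.2.1 := by
      rw [Multiset.countP_filter]
      refine Multiset.countP_congr rfl fun y hy => ?_
      have := hM _ hy
      simp only [RowInv]
      grind
    have h3 : (M.filter fun y => C ≤ y.2.1).filter (· ≠ (s, C, false)) =
        M.filter fun y => C + 1 ≤ y.2.1 := by
      rw [Multiset.filter_filter]
      refine Multiset.filter_congr fun y hy => ?_
      have := hM _ hy
      obtain ⟨y1, y2, y3⟩ := y
      grind
    simp only [true_and] at h
    rw [h1, h2, h3] at h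
    rw [Finset.prod_range_succ, Finset.prod_range_succ, ← mul_assoc, ih, mul_assoc, h]
    ring

theorem countP_le_succ (hM : ∀ y ∈ M, y.1 = s ∧ y.2.2 = false) (c : ℕ) :
    (M.countP fun y => c ≤ y.2.1) =
      (M.countP fun y => c + 1 ≤ y.2.1) + M.count (s, c, false) := by
  rw [Multiset.countP_eq_countP_filter_add _ _ fun y => c + 1 ≤ y.2.1, Multiset.countP_filter,
    Multiset.countP_filter, Multiset.count]
  congr 1 <;> refine Multiset.countP_congr rfl fun y hy => ?_
  · grind
  · have := hM _ hy
    obtain ⟨y1, y2, y3⟩ := y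
    grind

/-- The enumerator of the words on a single diagonal. -/
theorem rowSum_base (hM : ∀ y ∈ M, y.1 = s ∧ y.2.2 = false) (hP : 0 < posCount M s) (C : ℕ)
    (hC : ∀ y ∈ M, y.2.1 < C) :
    rowSum s M * ∏ c ∈ Finset.range C, qRising q 1 (M.count (s, c, false)) =
      qNat q (posCount M s) * qRising q 1 (M.card - 1) := by
  have hP' : posCount M s = M.countP fun y => 1 ≤ y.2.1 :=
    Multiset.countP_congr rfl fun y hy => by simp [hM y hy, Nat.one_le_iff_ne_zero, Nat.pos_iff_ne_zero]
  have hfil : (M.filter fun y => C ≤ y.2.1) = 0 :=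
    Multiset.filter_eq_nil.2 fun y hy => by simpa using hC y hy
  have hcard : M.card = M.countP fun y => 0 ≤ y.2.1 := by simp
  rw [rowSum_strip_base hM, hfil, rowSum_zero, mul_one]
  obtain ⟨D, rfl⟩ : ∃ D, C = D + 1 := ⟨C - 1, by
    obtain ⟨y, hy, -⟩ := Multiset.countP_pos.1 hP
    have := hC y hy
    omega⟩
  -- The virtual row adds a gap for each label `c > 0`, and their rising factorials concatenate to
  -- [P]!. Label `0` has no such gap and contributes [P]...[P+m-1], so [P] occurs twice.
  have h : ∀ D, qRising q 1 (M.countP fun y => 1 ≤ y.2.1) =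
      (∏ c ∈ Finset.range D, qRising q ((M.countP fun y => c + 1 + 1 ≤ y.2.1) + 1)
        (M.count (s, c + 1, false))) * qRising q 1 (M.countP fun y => D + 1 ≤ y.2.1) := by
    intro D
    induction D with
    | zero => simp
    | succ D ih =>
      rw [ih, countP_le_succ hM (D + 1), qRising_add, Finset.prod_range_succ, add_comm 1]
      ring
  have h0 : (M.countP fun y => D + 1 ≤ y.2.1) = 0 :=
    Multiset.countP_eq_zero.2 fun y hy => by simpa using hC y hy
  have hD := h D
  rw [h0, qRising_zero, mul_one] at hD
  rw [Finset.prod_range_succ']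
  simp only [Nat.succ_pos, if_true, lt_irrefl, if_false, add_zero]
  rw [← hD, hcard, countP_le_succ hM 0, zero_add, ← hP']
  obtain ⟨P, hP2⟩ : ∃ P, posCount M s = P + 1 := ⟨posCount M s - 1, by omega⟩
  rw [hP2, show P + 1 + M.count (s, 0, false) - 1 = P + M.count (s, 0, false) by omega,
    qRising_add q 1 P (M.count _), qRising_succ q 1 P, add_comm 1 P]
  ring

end TwoDiagonals

theorem countP_eq_add {α : Type*} (M : Multiset α) (P Q R : α → Prop) [DecidablePred P]
    [DecidablePred Q] [DecidablePred R] (h : ∀ y ∈ M, (P y ↔ Q y ∨ R y) ∧ ¬ (Q y ∧ R y)) :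
    M.countP P = M.countP Q + M.countP R := by
  induction M using Multiset.induction_on with
  | empty => simp
  | cons a M ih =>
    have ha := h a (Multiset.mem_cons_self a M)
    rw [Multiset.countP_cons, Multiset.countP_cons, Multiset.countP_cons,
      ih fun y hy => h y (Multiset.mem_cons_of_mem hy)]
    split_ifs <;> first | omega | (exfalso; tauto)

theorem posCount_filter (M : Multiset Row) (i : ℤ) (P : Row → Prop) [DecidablePred P]
    (h : ∀ y : Row, y.1 = i → y.2.2 = false → P y) : posCount (M.filter P) i = posCount M i := by
  rw [posCount, posCount, Multiset.countP_filter]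
  refine Multiset.countP_congr rfl fun y _ => ?_
  have := h y
  grind

theorem qNat_posCount_mul_rowSum_of_two {s : ℤ} {M : Multiset Row}
    (hM : ∀ y ∈ M, (y.1 = s ∨ y.1 = s + 1) ∧ y.2.2 = false) :
    qNat q (posCount M s) * rowSum (s + 1) M = qNat q (posCount M (s + 1)) * rowSum s M := by
  by_cases hcross : ∃ u ∈ M, ∃ v ∈ M, u.1 = s ∧ v.1 = s + 1 ∧ u.2.1 < v.2.1 ∧ v.2.2 = false
  · rcases Nat.eq_zero_or_pos (posCount M s) with hP | hP
    -- An arrangement of shift `s` reaching diagonal `s` climbs onto it from level `s - 1`, which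
    -- needs a positive label there.
    · rw [hP, qNat_zero, zero_mul, eq_comm]
      by_contra hne
      obtain ⟨u, hu, v, hv, h1, h2, h3⟩ := hcross
      obtain ⟨u', -, v', hv', -, h2', h3'⟩ := exists_climb_above (right_ne_zero_of_mul hne)
        (i := s - 1) le_rfl hu (by omega)
      have := posCount_pos_of_mem (i := s) hv' (by omega) h3'
      omega
    · have hP' : 0 < posCount M (s + 1) := by
        obtain ⟨u, hu, v, hv, h1, h2, h3⟩ := hcross
        exact posCount_pos_of_mem hv h2 h3
      set C := M.toFinset.sup (fun y => y.2.1) + 1 with hCdef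
      have hC : ∀ y ∈ M, y.2.1 < C := fun y hy =>
        Nat.lt_succ_of_le (Finset.le_sup (f := fun y : Row => y.2.1) (Multiset.mem_toFinset.2 hy))
      have e1 := rowSum_strip_top hM C
      have e2 := rowSum_strip_bottom hM C
      rw [Multiset.filter_congr (q := fun y => y.1 = s) fun y hy => by have := hC y hy; grind] at e1
      rw [Multiset.filter_eq_self.2 fun y hy => Or.inr (hC y hy)] at e2
      have e3 := rowSum_base (s := s) (M := M.filter fun y => y.1 = s) (fun y hy => by
        obtain ⟨h1, h2⟩ := Multiset.mem_filter.1 hy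
        exact ⟨h2, (hM y h1).2⟩) (by rwa [posCount_filter _ _ _ fun _ h _ => h]) C
        fun y hy => hC y (Multiset.mem_filter.1 hy).1
      have e4 := rowSum_base (s := s + 1) (M := M.filter fun y => y.1 = s + 1) (fun y hy => by
        obtain ⟨h1, h2⟩ := Multiset.mem_filter.1 hy
        exact ⟨h2, (hM y h1).2⟩) (by rwa [posCount_filter _ _ _ fun _ h _ => h]) C
        fun y hy => hC y (Multiset.mem_filter.1 hy).1
      rw [posCount_filter _ _ _ fun _ h _ => h] at e3 e4
      rw [Finset.prod_congr rfl fun c _ => congrArg _ (Multiset.count_filter_of_pos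
        (p := fun y : Row => y.1 = s) (a := (s, c, false)) rfl)] at e3
      rw [Finset.prod_congr rfl fun c _ => congrArg _ (Multiset.count_filter_of_pos
        (p := fun y : Row => y.1 = s + 1) (a := (s + 1, c, false)) rfl)] at e4
      have tel := prod_qRising_telescope q
        (fun c => M.countP fun y => y.1 = s ∧ y.2.1 < c ∨ y.1 = s + 1 ∧ c < y.2.1)
        (fun c => M.count (s + 1, c, false)) (fun c => M.count (s, c, false)) C
        (fun c _ => by
          obtain ⟨u, hu, v, hv, h1, h2, h3⟩ := hcross
          -- For every `c`, the climbing pair has its lower label below `c` or its upper label above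
          -- `c`.
          refine Multiset.countP_pos.2 ?_
          by_cases hc : u.2.1 < c
          · exact ⟨u, hu, Or.inl ⟨h1, hc⟩⟩
          · exact ⟨v, hv, Or.inr ⟨h2, by omega⟩⟩)
        (fun c => by
          simp only [Multiset.count]
          rw [← countP_eq_add M (fun y => y.1 = s ∧ y.2.1 < c + 1 ∨ y.1 = s + 1 ∧ c < y.2.1),
            ← countP_eq_add M (fun y => y.1 = s ∧ y.2.1 < c + 1 ∨ y.1 = s + 1 ∧ c < y.2.1)] <;>
          · rintro ⟨y1, y2, y3⟩ hy
            have := hM _ hy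
            grind)
      -- The two ends of the telescope are the sizes of the two diagonals, which match the
      -- factorials supplied by `rowSum_base`.
      have c1 : (M.countP fun y => y.1 = s ∧ y.2.1 < 0 ∨ y.1 = s + 1 ∧ 0 < y.2.1) +
          M.count (s + 1, 0, false) = (M.filter fun y => y.1 = s + 1).card := by
        rw [← Multiset.countP_eq_card_filter, Multiset.count, eq_comm]
        refine countP_eq_add _ _ _ _ ?_
        rintro ⟨y1, y2, y3⟩ hy
        have := hM _ hy
        grind
      have c2 : (M.countP fun y => y.1 = s ∧ y.2.1 < C ∨ y.1 = s + 1 ∧ C < y.2.1) +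
          M.count (s + 1, C, false) = (M.filter fun y => y.1 = s).card := by
        rw [← Multiset.countP_eq_card_filter, Multiset.count, eq_comm]
        refine countP_eq_add _ _ _ _ ?_
        rintro ⟨y1, y2, y3⟩ hy
        have := hM _ hy
        have := hC _ hy
        grind
      simp only [c1, c2] at tel
      have d1 : ∏ c ∈ Finset.range C, qRising q 1 (M.count (s + 1, c, false)) ≠ 0 :=
        Finset.prod_ne_zero_iff.2 fun c _ => qRising_one_ne_zero _
      have d2 : ∏ c ∈ Finset.range C, qRising q 1 (M.count (s, c, false)) ≠ 0 :=
        Finset.prod_ne_zero_iff.2 fun c _ => qRising_one_ne_zero _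
      refine mul_right_cancel₀ (mul_ne_zero d1 d2) ?_
      generalize (∏ c ∈ Finset.range C, qRising q 1 (M.count (s + 1, c, false))) = D1 at *
      generalize (∏ c ∈ Finset.range C, qRising q 1 (M.count (s, c, false))) = D2 at *
      generalize hU : (∏ c ∈ Finset.range C, qRising q _ (M.count (s + 1, c, false))) = U at *
      generalize hV : (∏ c ∈ Finset.range C, qRising q _ (M.count (s, c, false))) = V at *
      linear_combination (qNat q (posCount M s) * D1) * e2 + qNat q (posCount M s) * V * e4 -
        (qNat q (posCount M (s + 1)) * D2) * e1 - qNat q (posCount M (s + 1)) * U * e3 +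
        qNat q (posCount M s) * qNat q (posCount M (s + 1)) * tel
  -- Without a climbing pair both sides vanish: any arrangement counted would have to climb from `s`
  -- to `s + 1`.
  · have h1 : posCount M s = 0 ∨ rowSum (s + 1) M = 0 := by
      by_contra! h
      obtain ⟨x, hx, hxs, -⟩ := Multiset.countP_pos.1 (Nat.pos_of_ne_zero h.1)
      exact hcross (exists_climb_below h.2 (i := s) (by omega) hx hxs.le)
    have h2 : posCount M (s + 1) = 0 ∨ rowSum s M = 0 := by
      by_contra! h
      obtain ⟨y, hy, hys, -⟩ := Multiset.countP_pos.1 (Nat.pos_of_ne_zero h.1)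
      obtain ⟨u, hu, v, hv, h'⟩ := exists_climb_above h.2 (i := s) (by omega) hy (by omega)
      refine hcross ⟨u, hu.resolve_left ?_, v, hv, h'⟩
      rintro rfl
      have := h'.1
      simp only [startRow] at this
      omega
    have h1' : qNat q (posCount M s) * rowSum (s + 1) M = 0 := by
      rcases h1 with h | h <;> simp [h]
    have h2' : qNat q (posCount M (s + 1)) * rowSum s M = 0 := by
      rcases h2 with h | h <;> simp [h]
    rw [h1', h2']

/-! ### Undecorated words: changing the shift -/

theorem posCount_filter_ne (M : Multiset Row) (i : ℤ) (x : Row) (h : x.1 ≠ i ∨ x.2.2 = true) :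
    posCount (M.filter (· ≠ x)) i = posCount M i := by
  refine posCount_filter M i _ fun y h1 h2 => ?_
  rintro rfl
  rcases h with h | h
  · exact h h1
  · simp [h] at h2

theorem card_filter_ne_lt {M : Multiset Row} {x : Row} (hx : x ∈ M) :
    (M.filter (· ≠ x)).card < M.card :=
  Multiset.card_lt_card (lt_of_le_of_ne (Multiset.filter_le _ _) fun h =>
    Multiset.filter_eq_self.1 h x hx rfl)

/-- Comparison of the shifts `s` and `s + 1` for words without decorations. -/
theorem qNat_posCount_mul_rowSum_succ (s : ℤ) (M : Multiset Row) (hM : ∀ y ∈ M, y.2.2 = false) :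
    qNat q (posCount M s) * rowSum (s + 1) M = qNat q (posCount M (s + 1)) * rowSum s M := by
  induction hn : M.card using Nat.strong_induction_on generalizing M with
  | _ n ih =>
  subst hn
  by_cases htop : ∃ y ∈ M, s + 1 < y.1
  · obtain ⟨y, hy, hys⟩ := htop
    -- The sign of the label selects the smallest label on the highest diagonal; the minimum of the
    -- same key is the largest label on the lowest one.
    obtain ⟨x, hx, hmax⟩ := Finset.exists_max_image M.toFinset
      (fun y : Row => toLex (y.1, -(y.2.1 : ℤ))) ⟨y, by simpa using hy⟩
    simp only [Multiset.mem_toFinset, Prod.Lex.toLex_le_toLex] at hx hmax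
    obtain ⟨i, c, d⟩ := x
    obtain rfl : d = false := hM _ hx
    have hi : s + 1 < i := by have := hmax y hy; grind
    have hM' := ih _ (card_filter_ne_lt hx) (M.filter (· ≠ (i, c, false)))
      (fun y hy => hM y (Multiset.mem_filter.1 hy).1) rfl
    have h1 := rowSum_mul_eq_of_top s i c M (by omega) (by
      rintro ⟨y1, y2, y3⟩ hy hne
      have := hmax _ hy
      have := hM _ hy
      grind)
    have h2 := rowSum_mul_eq_of_top (s + 1) i c M (by omega) (by
      rintro ⟨y1, y2, y3⟩ hy hne
      have := hmax _ hy
      have := hM _ hy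
      grind)
    -- As `i > s + 1`, the virtual row offers no gap at either shift, so the two factors agree.
    rw [if_neg (by omega)] at h1 h2
    rw [posCount_filter_ne _ _ _ (Or.inl (by dsimp only; omega)), posCount_filter_ne _ _ _ (Or.inl (by dsimp only; omega))] at hM'
    refine mul_right_cancel₀ (qRising_one_ne_zero (M.count (i, c, false))) ?_
    rw [mul_assoc, h2, mul_assoc, h1, mul_left_comm, hM']
    ring
  by_cases hbot : ∃ y ∈ M, y.1 < s
  · obtain ⟨y, hy, hys⟩ := hbot
    obtain ⟨x, hx, hmax⟩ := Finset.exists_min_image M.toFinset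
      (fun y : Row => toLex (y.1, -(y.2.1 : ℤ))) ⟨y, by simpa using hy⟩
    simp only [Multiset.mem_toFinset, Prod.Lex.toLex_le_toLex] at hx hmax
    obtain ⟨i, c, d⟩ := x
    obtain rfl : d = false := hM _ hx
    have hi : i < s := by have := hmax y hy; grind
    have hM' := ih _ (card_filter_ne_lt hx) (M.filter (· ≠ (i, c, false)))
      (fun y hy => hM y (Multiset.mem_filter.1 hy).1) rfl
    have h1 := rowSum_mul_eq_of_bottom s i c M (by omega) (by
      rintro ⟨y1, y2, y3⟩ hy hne
      have := hmax _ hy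
      have := hM _ hy
      grind)
    have h2 := rowSum_mul_eq_of_bottom (s + 1) i c M (by omega) (by
      rintro ⟨y1, y2, y3⟩ hy hne
      have := hmax _ hy
      have := hM _ hy
      grind)
    rw [posCount_filter_ne _ _ _ (Or.inl (by dsimp only; omega)), posCount_filter_ne _ _ _ (Or.inl (by dsimp only; omega))] at hM'
    refine mul_right_cancel₀ (qRising_one_ne_zero (M.count (i, c, false))) ?_
    rw [mul_assoc, h2, mul_assoc, h1, mul_left_comm, hM']
    ring
  push Not at htop hbot
  exact qNat_posCount_mul_rowSum_of_two fun y hy =>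
    ⟨by have := htop y hy; have := hbot y hy; omega, hM y hy⟩

/-- Comparison of the shifts `0` and `s` for words without decorations. -/
theorem qNat_posCount_zero_mul_rowSum (s : ℕ) (M : Multiset Row) (hM : ∀ y ∈ M, y.2.2 = false)
    (hP : 0 < posCount M 0) :
    qNat q (posCount M 0) * rowSum s M = qNat q (posCount M s) * rowSum 0 M := by
  by_cases hpos : ∀ i < s, 0 < posCount M i
  · induction s with
    | zero => simp
    | succ s ih =>
      have h1 := ih fun i hi => hpos i (by omega)
      have h2 := qNat_posCount_mul_rowSum_succ s M hM
      have h3 : qNat q (posCount M s) ≠ 0 := by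
        obtain ⟨n, hn⟩ := Nat.exists_eq_succ_of_ne_zero (hpos s (by simp)).ne'
        rw [hn]
        exact qNat_ne_zero n
      push_cast
      refine mul_left_cancel₀ h3 ?_
      rw [mul_left_comm, h2, mul_left_comm, h1]
      ring
  -- A diagonal `i < s` without positive labels cannot be climbed onto. This blocks every
  -- arrangement of shift `s`, and those of shift `0` that reach diagonal `s`.
  · push Not at hpos
    obtain ⟨i, hi, hi0⟩ := hpos
    have hi1 : i ≠ 0 := by rintro rfl; simp at hi0; omega
    have h1 : rowSum s M = 0 := by
      by_contra hne
      obtain ⟨x, hx, hx0, -⟩ := Multiset.countP_pos.1 hP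
      obtain ⟨u, -, v, hv, -, h2, h3⟩ := exists_climb_below hne (i := i - 1) (by omega) hx (by omega)
      have := posCount_pos_of_mem (i := i) hv (by omega) h3
      omega
    have h2 : posCount M s = 0 ∨ rowSum 0 M = 0 := by
      by_contra! h
      obtain ⟨y, hy, hys, -⟩ := Multiset.countP_pos.1 (Nat.pos_of_ne_zero h.1)
      obtain ⟨u, -, v, hv, -, h2, h3⟩ :=
        exists_climb_above h.2 (i := i - 1) (by omega) hy (by omega)
      have := posCount_pos_of_mem (i := i) hv (by omega) h3
      omega
    rw [h1, mul_zero]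
    rcases h2 with h | h <;> simp [h]

/-! ## Decorated rows -/

theorem map_pow_succ (L : List ℕ) :
    (L.map fun j => q ^ (j + 1)) = (L.map fun j => q ^ j).map (q * ·) := by
  simp [pow_succ', Function.comp_def]

/-- At shift `0` the initial gap is closed and the final one open, so the W gaps have weights q,
..., q^W. -/
theorem rowSum_zero_of_decorated (i : ℤ) (hi : 0 ≤ i) (c : ℕ) (M : Multiset Row) :
    rowSum 0 M = q ^ M.count (i, c, true) *
      esymmList ((List.range (M.countP (RowInv · (i, c, true)))).map fun j => q ^ j)
        (M.count (i, c, true)) * rowSum 0 (M.filter (· ≠ (i, c, true))) := by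
  rw [rowSum_eq_of_decorated 0 i c M]
  simp only [if_pos hi, if_neg (show ¬ (i < 0 - 1 ∨ i = 0 - 1 ∧ 0 < c) by omega), map_pow_succ,
    esymmList_map_mul, add_zero, Nat.add_sub_cancel]

/-- A decorated row on a diagonal at or above `s` contributes equally at both shifts. Below `s` its
gap weights at shift `s` are 1, ..., q^(W-1), one factor q less per copy than at shift `0`. -/
theorem rowSum_of_no_special (s : ℕ) (M : Multiset Row) (hM : ∀ y ∈ M, 0 ≤ y.1)
    (hP : 0 < posCount M 0) (hs : ((s : ℤ) - 1, 0, true) ∉ M) :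
    q ^ (M.countP fun y => y.1 < (s : ℤ) ∧ y.2.2 = true) * (qNat q (posCount M 0) * rowSum s M) =
      qNat q (posCount M s) * rowSum 0 M := by
  induction hn : M.card using Nat.strong_induction_on generalizing M with
  | _ n ih =>
  subst hn
  by_cases hdec : ∃ y ∈ M, y.2.2 = true
  · obtain ⟨⟨i, c, d⟩, hx, hd⟩ := hdec
    obtain rfl : d = true := hd
    have hne : ¬ (i = s - 1 ∧ c = 0) := by rintro ⟨rfl, rfl⟩; exact hs hx
    have ih' := ih _ (card_filter_ne_lt hx) (M.filter (· ≠ (i, c, true)))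
      (fun y hy => hM y (Multiset.mem_filter.1 hy).1)
      (by rwa [posCount_filter_ne _ _ _ (Or.inr rfl)])
      (fun h => hs (Multiset.mem_filter.1 h).1) rfl
    rw [posCount_filter_ne _ _ _ (Or.inr rfl), posCount_filter_ne _ _ _ (Or.inr rfl)] at ih'
    have hc : (M.countP fun y => y.1 < (s : ℤ) ∧ y.2.2 = true) =
        ((M.filter (· ≠ (i, c, true))).countP fun y => y.1 < (s : ℤ) ∧ y.2.2 = true) +
          if i < s then M.count (i, c, true) else 0 := by
      rw [Multiset.countP_filter]
      split_ifs with his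
      · rw [Multiset.count]
        refine countP_eq_add _ _ _ _ fun y _ => ?_
        obtain ⟨y1, y2, y3⟩ := y
        grind
      · refine Multiset.countP_congr rfl fun y _ => ?_
        obtain ⟨y1, y2, y3⟩ := y
        grind
    rw [rowSum_zero_of_decorated i (hM _ hx) c M, rowSum_eq_of_decorated s i c M, hc, pow_add]
    rcases lt_or_ge i (s : ℤ) with his | his
    · simp only [if_pos his, if_neg his.not_ge,
        if_pos (show i < s - 1 ∨ i = s - 1 ∧ 0 < c by omega), add_zero, Nat.add_sub_cancel]
      rw [mul_left_comm (qNat q (posCount M s)), ← ih']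
      ring
    · simp only [if_neg his.not_gt, if_pos his,
        if_neg (show ¬ (i < s - 1 ∨ i = s - 1 ∧ 0 < c) by omega), add_zero, Nat.add_sub_cancel,
        map_pow_succ, esymmList_map_mul]
      rw [mul_left_comm (qNat q (posCount M s)), ← ih']
      ring
  · push Not at hdec
    rw [Multiset.countP_eq_zero.2 fun y hy h => hdec y hy h.2, pow_zero, one_mul]
    exact qNat_posCount_zero_mul_rowSum s M (fun y hy => by simpa using hdec y hy) hP

/-- Comparison of the shifts `0` and `s`. -/
theorem rowSum_comparison (s : ℕ) (M : Multiset Row) (hM : ∀ y ∈ M, 0 ≤ y.1)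
    (hP : 0 < posCount M 0) :
    q ^ (M.countP fun y => y.1 < (s : ℤ) ∧ y.2.2 = true ∧ y ≠ ((s : ℤ) - 1, 0, true)) *
        (qNat q (posCount M 0) * rowSum s M) =
      qNat q (posCount M s - M.count ((s : ℤ) - 1, 0, true)) * rowSum 0 M ∧
    (posCount M s < M.count ((s : ℤ) - 1, 0, true) → rowSum 0 M = 0) := by
  by_cases hx : ((s : ℤ) - 1, 0, true) ∈ M
  · have hs : 0 ≤ (s : ℤ) - 1 := hM _ hx
    -- No label is smaller than `0`, so only undecorated positive rows one diagonal higher invert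
    -- with a marked zero.
    have hW : M.countP (RowInv · ((s : ℤ) - 1, 0, true)) = posCount M s := by
      refine Multiset.countP_congr rfl fun y _ => ?_
      simp only [RowInv]
      grind
    have h0 := rowSum_zero_of_decorated (s - 1) hs 0 M
    rw [hW] at h0
    refine ⟨?_, fun h => ?_⟩
    · have h' := rowSum_of_no_special s (M.filter (· ≠ ((s : ℤ) - 1, 0, true)))
        (fun y hy => hM y (Multiset.mem_filter.1 hy).1)
        (by rwa [posCount_filter_ne _ _ _ (Or.inr rfl)]) (by simp)
      rw [posCount_filter_ne _ _ _ (Or.inr rfl), posCount_filter_ne _ _ _ (Or.inr rfl),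
        Multiset.countP_filter] at h'
      simp only [and_assoc] at h'
      rw [h0, rowSum_eq_of_decorated s (s - 1) 0 M, hW]
      simp only [lt_irrefl, and_false, or_false, if_false,
        if_neg (show ¬ (s : ℤ) ≤ s - 1 by omega), add_zero, map_pow_succ, esymmList_map_mul]
      -- At shift `s` both outer gaps are closed, leaving W - 1 gaps against W at shift `0`.
      have h3 := qNat_mul_esymmList_range q qNat_ne_zero (posCount M s)
        (M.count ((s : ℤ) - 1, 0, true))
      linear_combination (q ^ M.count ((s : ℤ) - 1, 0, true) * esymmList ((List.range
        (posCount M s - 1)).map fun j => q ^ j) (M.count ((s : ℤ) - 1, 0, true))) * h' +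
        (q ^ M.count ((s : ℤ) - 1, 0, true) *
          rowSum 0 (M.filter (· ≠ ((s : ℤ) - 1, 0, true)))) * h3
    · rw [h0, esymmList_range_eq_zero q qNat_ne_zero h]
      simp
  · have h' := rowSum_of_no_special s M hM hP hx
    rw [Multiset.count_eq_zero_of_notMem hx]
    refine ⟨?_, by simp⟩
    rw [Nat.sub_zero, ← h']
    congr 2
    refine Multiset.countP_congr rfl fun y hy => ?_
    have : y ≠ ((s : ℤ) - 1, 0, true) := fun h => hx (h ▸ hy)
    simp [this]

/-! ## Square paths and their area words -/

/-- The steps of a path from a point with `y - x = d`, with given levels of the north steps, to a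
point with `y - x = 0`. -/
def stepsOf : ℤ → List ℤ → List Step
  | d, [] => List.replicate d.toNat Step.east
  | d, a :: l => List.replicate (d - a).toNat Step.east ++ Step.north :: stepsOf (a + 1) l

theorem startLevels_replicate_append (d : ℤ) (k : ℕ) (l : List Step) :
    startLevels d (List.replicate k Step.east ++ l) = startLevels (d - k) l := by
  induction k generalizing d with
  | zero => simp
  | succ k ih =>
    rw [List.replicate_succ, List.cons_append, startLevels, ih]
    congr 1
    push_cast
    ring

theorem startLevels_stepsOf (d : ℤ) (l : List ℤ)
    (h : List.IsChain (fun p y => y ≤ p + 1) ((d - 1) :: l)) : startLevels d (stepsOf d l) = l := by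
  induction l generalizing d with
  | nil =>
    have := startLevels_replicate_append d d.toNat []
    rw [List.append_nil] at this
    rw [stepsOf, this, startLevels]
  | cons a l ih =>
    rw [List.isChain_cons_cons] at h
    have e : d - ((d - a).toNat : ℤ) = a := by omega
    rw [stepsOf, startLevels_replicate_append, e, startLevels, ih (a + 1) (by simpa using h.2)]

theorem isChain_startLevels (d : ℤ) (l : List Step) :
    List.IsChain (fun p y => y ≤ p + 1) ((d - 1) :: startLevels d l) := by
  induction l generalizing d with
  | nil => simp [startLevels]
  | cons x l ih =>
    cases x with
    | north =>
      rw [startLevels, List.isChain_cons_cons]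
      exact ⟨by omega, by simpa using ih (d + 1)⟩
    | east =>
      rw [startLevels]
      have := ih (d - 1)
      rw [List.isChain_cons] at this ⊢
      exact ⟨fun y hy => by have := this.1 y hy; omega, this.2⟩

theorem stepsOf_startLevels (d : ℤ) (l : List Step)
    (h : d + l.count Step.north = l.count Step.east) : stepsOf d (startLevels d l) = l := by
  induction l generalizing d with
  | nil =>
    have : d = 0 := by simpa using h
    simp [startLevels, stepsOf, this]
  | cons x l ih =>
    cases x with
    | north =>
      simp only [List.count_cons_self, List.count_cons_of_ne (show Step.north ≠ Step.east by decide),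
        Nat.cast_add, Nat.cast_one] at h
      rw [startLevels, stepsOf, ih (d + 1) (by omega)]
      simp
    | east =>
      simp only [List.count_cons_self, List.count_cons_of_ne (show Step.east ≠ Step.north by decide),
        Nat.cast_add, Nat.cast_one] at h
      have ih' := ih (d - 1) (by omega)
      have hc := isChain_startLevels (d - 1) l
      rw [startLevels]
      cases hl : startLevels (d - 1) l with
      | nil =>
        rw [hl] at ih'
        have h0 : l.count Step.north = 0 := by rw [← length_startLevels (d - 1), hl]; rfl
        rw [← ih', stepsOf, stepsOf, show d.toNat = (d - 1).toNat + 1 by omega,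
          List.replicate_succ]
      | cons a L =>
        rw [hl] at ih' hc
        have := (List.isChain_cons_cons.1 hc).1
        rw [stepsOf] at ih' ⊢
        rw [show (d - a).toNat = (d - 1 - a).toNat + 1 by omega, List.replicate_succ,
          List.cons_append, ih']

/-- The bound `-1` means that the path stands at or above `y = x` after its last north step, so east
steps alone bring it back. -/
theorem count_stepsOf (d : ℤ) (l : List ℤ)
    (h : List.IsChain (fun p y => y ≤ p + 1) ((d - 1) :: l))
    (h' : ∀ a ∈ ((d - 1) :: l).getLast?, -1 ≤ a) :
    (stepsOf d l).count Step.north = l.length ∧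
      d + (stepsOf d l).count Step.north = (stepsOf d l).count Step.east := by
  induction l generalizing d with
  | nil =>
    have : -1 ≤ d - 1 := h' _ (by simp)
    simp [stepsOf, List.count_replicate]
    omega
  | cons a l ih =>
    rw [List.isChain_cons_cons] at h
    obtain ⟨h1, h2⟩ := ih (a + 1) (by simpa using h.2) (by simpa using h')
    simp [stepsOf, List.count_replicate] at h1 h2 ⊢
    omega

theorem getLast_stepsOf (d : ℤ) (l : List ℤ) (h' : ∀ a ∈ l.getLast?, 0 ≤ a)
    (hne : stepsOf d l ≠ []) : (stepsOf d l).getLast hne = Step.east := by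
  induction l generalizing d with
  | nil =>
    refine List.eq_of_mem_replicate (n := d.toNat) ?_
    exact List.getLast_mem (l := stepsOf d []) hne
  | cons a l ih =>
    have hne' : stepsOf (a + 1) l ≠ [] := by
      cases l with
      | nil =>
        have : 0 ≤ a := h' a (by simp)
        simp [stepsOf]
        omega
      | cons b l => simp [stepsOf]
    simp only [stepsOf, List.getLast_append_of_ne_nil _ (List.cons_ne_nil _ _),
      List.getLast_cons hne']
    refine ih _ (fun b hb => h' b ?_) hne'
    cases l with
    | nil => simp at hb
    | cons c l => simpa using hb

theorem nonneg_of_mem_getLast_startLevels (d : ℤ) (l : List Step)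
    (h : d + l.count Step.north = l.count Step.east) (hl : ∀ h : l ≠ [], l.getLast h = Step.east)
    (a : ℤ) (ha : a ∈ (startLevels d l).getLast?) : 0 ≤ a := by
  induction l generalizing d with
  | nil => simp [startLevels] at ha
  | cons x l ih =>
    cases x with
    | north =>
      simp only [List.count_cons_self, List.count_cons_of_ne (show Step.north ≠ Step.east by decide),
        Nat.cast_add, Nat.cast_one] at h
      have hne : l ≠ [] := by
        rintro rfl
        simpa using hl (by simp)
      have hl' : ∀ h : l ≠ [], l.getLast h = Step.east := fun h' => by
        rw [← hl (by simp), List.getLast_cons]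
      cases hs : startLevels (d + 1) l with
      | nil =>
        have h0 : l.count Step.north = 0 := by rw [← length_startLevels (d + 1), hs]; rfl
        have h1 := SquarePath.length_steps l
        have := List.length_pos_iff.2 hne
        simp [startLevels, hs] at ha
        omega
      | cons b L =>
        refine ih (d + 1) (by omega) hl' ?_
        simpa [startLevels, hs] using ha
    | east =>
      simp only [List.count_cons_self, List.count_cons_of_ne (show Step.east ≠ Step.north by decide),
        Nat.cast_add, Nat.cast_one] at h
      refine ih (d - 1) (by omega) (fun h' => ?_) (by simpa [startLevels] using ha)
      rw [← hl (by simp), List.getLast_cons]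

/-- From any point, east steps only lower the level until a north step begins or the path ends. The
shift can thus be read off the area word. -/
theorem exists_startLevel_le (d : ℤ) (l : List Step) (j : ℕ) :
    (∃ a ∈ startLevels d l, a ≤ d + level l j) ∨
      d + l.count Step.north - l.count Step.east ≤ d + level l j := by
  induction l generalizing d j with
  | nil => right; simp [level]
  | cons x l ih =>
    cases x with
    | north =>
      cases j with
      | zero => exact Or.inl ⟨d, by simp [startLevels], by simp [level]⟩
      | succ j =>
        have e : d + level (Step.north :: l) (j + 1) = d + 1 + level l j := by
          simp [level]; ring
        rw [e]
        rcases ih (d + 1) j with ⟨a, ha, h⟩ | h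
        · exact Or.inl ⟨a, by simp [startLevels, ha], h⟩
        · right; simp; omega
    | east =>
      cases j with
      | zero =>
        rcases ih (d - 1) 0 with ⟨a, ha, h⟩ | h
        · exact Or.inl ⟨a, by simpa [startLevels] using ha, by simp [level] at h ⊢; omega⟩
        · right; simp [level] at h ⊢; omega
      | succ j =>
        have e : d + level (Step.east :: l) (j + 1) = d - 1 + level l j := by
          simp [level]; ring
        rw [e]
        rcases ih (d - 1) j with ⟨a, ha, h⟩ | h
        · exact Or.inl ⟨a, by simpa [startLevels] using ha, h⟩
        · right; simp; omega

namespace SquarePath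

variable {n : ℕ}

theorem ext_startLevels {π π' : SquarePath n}
    (h : startLevels 0 π.steps = startLevels 0 π'.steps) : π = π' := by
  have h1 := stepsOf_startLevels 0 π.steps (by rw [π.count_north, π.count_east]; simp)
  have h2 := stepsOf_startLevels 0 π'.steps (by rw [π'.count_north, π'.count_east]; simp)
  have h3 : π.steps = π'.steps := by rw [← h1, h, h2]
  cases π; cases π'
  simpa using h3

theorem ofFn_a (π : SquarePath n) : List.ofFn π.a = startLevels 0 π.steps := by
  refine List.ext_getElem (by simp [length_startLevels, π.count_north]) fun i h1 h2 => ?_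
  simp [a]

theorem shift_eq {π : SquarePath n} {s : ℕ} (h : ∀ i, -(s : ℤ) ≤ π.a i)
    (h' : ∃ i, π.a i = -(s : ℤ)) : π.shift = s := by
  refine le_antisymm (Finset.sup_le fun j _ => ?_) ?_
  · rcases exists_startLevel_le 0 π.steps j with ⟨a, ha, hj⟩ | hj
    · rw [← ofFn_a, List.mem_ofFn] at ha
      obtain ⟨i, rfl⟩ := ha
      have := h i
      omega
    · rw [π.count_north, π.count_east] at hj
      omega
  · obtain ⟨i, hi⟩ := h'
    have := π.a_add_shift_nonneg i
    omega

end SquarePath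

/-! ## Labelled paths as words of rows -/

theorem follows_iff {α : Type*} {R : α → α → Prop} {E : α → Prop} {e : Prop} {p : α}
    {l : List α} : Follows R E e p l ↔
      (p :: l).IsChain R ∧ (l = [] → e) ∧ ∀ y ∈ l.getLast?, E y := by
  induction l generalizing e p with
  | nil => simp [Follows]
  | cons y l ih =>
    rw [Follows, ih, List.isChain_cons_cons]
    cases l with
    | nil => simp
    | cons x l => simp; tauto

theorem pairCount_ofFn {α : Type*} (I : α → α → Prop) [DecidableRel I] {n : ℕ} (f : Fin n → α) :
    pairCount I (List.ofFn f) =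
      (Finset.univ.filter fun p : Fin n × Fin n => p.1 < p.2 ∧ I (f p.1) (f p.2)).card := by
  have h : ∀ {n : ℕ} (f : Fin n → α), (Finset.univ.filter fun p : Fin n × Fin n =>
      p.1 < p.2 ∧ I (f p.1) (f p.2)).card =
      ∑ i, ∑ j, if i < j ∧ I (f i) (f j) then 1 else 0 := fun f => by
    rw [Finset.card_filter, Fintype.sum_prod_type]
  induction n with
  | zero => simp [pairCount]
  | succ n ih =>
    rw [List.ofFn_succ, pairCount, (ih _).trans (h _), h, Fin.sum_univ_succ]
    congr 1
    · rw [Fin.sum_univ_succ]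
      simp only [lt_irrefl, false_and, if_false, zero_add, Fin.succ_pos, true_and]
      rw [← Multiset.coe_countP, ← Fin.univ_val_map, Multiset.countP_map, ← Finset.card_filter]
      rfl
    · refine Finset.sum_congr rfl fun i _ => ?_
      rw [Fin.sum_univ_succ]
      simp

namespace ValleyPath

variable {n : ℕ}

/-- The `i`-th row of a labelled path. -/
def row (P : ValleyPath n) (i : Fin n) : Row :=
  (P.path.a i + P.path.shift, P.w i, decide (i ∈ P.dv))

/-- The word of rows of a labelled path. -/
def rows (P : ValleyPath n) : List Row := List.ofFn P.row

theorem rows_eq_map (P : ValleyPath n) : (P.rows : Multiset Row) = Finset.univ.val.map P.row := by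
  rw [rows, Fin.univ_val_map]

theorem countP_rows (P : ValleyPath n) (p : Row → Prop) [DecidablePred p] :
    (P.rows : Multiset Row).countP p = (Finset.univ.filter fun i => p (P.row i)).card := by
  rw [rows_eq_map, Multiset.countP_map]
  rfl

theorem dinv_eq (P : ValleyPath n) : P.dinv = pairCount RowInv P.rows +
    ((P.rows : Multiset Row).countP fun y => y.1 < (P.path.shift : ℤ) ∧ 0 < y.2.1) -
    (P.rows : Multiset Row).countP fun y => y.2.2 = true := by
  rw [dinv, countP_rows, countP_rows, rows, pairCount_ofFn]
  congr 3
  · congr 1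
    ext ⟨i, j⟩
    have : P.path.a i + P.path.shift = P.path.a j + P.path.shift + 1 ↔
        P.path.a i = P.path.a j + 1 := by omega
    rw [Finset.mem_filter, Finset.mem_filter]
    simp only [Finset.mem_univ, true_and, IsInversion, row, RowInv,
      decide_eq_false_iff_not, add_left_inj, this]
    tauto
  · simp [row]
  · simp [row]

theorem area_eq (P : ValleyPath n) :
    P.area = ((P.rows : Multiset Row).map fun y => y.1).sum := by
  rw [rows_eq_map, Multiset.map_map]
  rfl

theorem monomial_eq (P : ValleyPath n) : P.monomial = ((P.rows : Multiset Row).map fun y =>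
    if y.2.1 = 0 then (1 : MvPolynomial ℕ QT) else MvPolynomial.X y.2.1).prod := by
  rw [rows_eq_map, Multiset.map_map]
  rfl

theorem rows_injective {P P' : ValleyPath n} (hs : P.path.shift = P'.path.shift)
    (h : P.rows = P'.rows) : P = P' := by
  have h' : ∀ i, P.row i = P'.row i := fun i => congrFun (List.ofFn_injective h) i
  obtain ⟨p, w, dv, h1, h2⟩ := P
  obtain ⟨p', w', dv', h1', h2'⟩ := P'
  simp only [row, Prod.mk.injEq, decide_eq_decide] at h' hs
  obtain rfl : p = p' := SquarePath.ext_startLevels (by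
    rw [← SquarePath.ofFn_a, ← SquarePath.ofFn_a]
    congr 1
    funext i
    have := (h' i).1
    omega)
  obtain rfl : w = w' := funext fun i => (h' i).2.1
  obtain rfl : dv = dv' := Finset.ext fun i => (h' i).2.2
  rfl

/-- Adjacency to the virtual row says that a first row at level `s` is positive and undecorated, and
that a decorated one at level `s - 1` is positive. The final condition reflects the last east step.
-/
theorem follows_rows (P : ValleyPath n) : Follows RowAdj (fun y => (P.path.shift : ℤ) ≤ y.1) True
    (startRow P.path.shift) P.rows := by
  have hc := isChain_startLevels 0 P.path.steps
  rw [← P.path.ofFn_a, List.isChain_iff_getElem] at hc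
  refine follows_iff.2 ⟨List.isChain_iff_getElem.2 fun i hi => ?_, fun _ => trivial, fun y hy => ?_⟩
  · have hin : i < n := by simpa [rows] using hi
    have hci := hc i (by simpa using hin)
    simp only [List.getElem_cons_succ, rows, List.getElem_ofFn] at hci ⊢
    cases i with
    | zero =>
      simp only [List.getElem_cons_zero] at hci ⊢
      have h1 := P.labelling.first ⟨0, hin⟩ rfl
      have h2 := P.contractible ⟨0, hin⟩
      simp only [IsContractibleValley] at h2
      simp only [RowAdj, row, startRow]
      grind
    | succ i =>
      simp only [List.getElem_cons_succ, List.getElem_ofFn] at hci ⊢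
      have hi' : i < n := by omega
      have h1 := P.labelling.column ⟨i, hi'⟩ ⟨i + 1, hin⟩ rfl
      have h2 : (⟨i + 1, hin⟩ : Fin n) ∈ P.dv →
          P.path.a ⟨i + 1, hin⟩ < P.path.a ⟨i, hi'⟩ ∨
          P.path.a ⟨i + 1, hin⟩ = P.path.a ⟨i, hi'⟩ ∧ P.w ⟨i, hi'⟩ < P.w ⟨i + 1, hin⟩ := by
        intro h
        rcases P.contractible _ h with h' | ⟨j, hj, h'⟩
        · simp at h'
        · have : j = ⟨i, hi'⟩ := Fin.ext (by simpa using hj)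
          exact this ▸ h'
      simp only [RowAdj, row]
      grind
  · have h0 := nonneg_of_mem_getLast_startLevels 0 P.path.steps
      (by rw [P.path.count_north, P.path.count_east]; simp) P.path.ends_east
    rw [← P.path.ofFn_a] at h0
    cases n with
    | zero => simp [rows] at hy
    | succ n =>
      have e : ∀ {β : Type} (f : Fin (n + 1) → β), (List.ofFn f).getLast? = some (f (Fin.last n)) :=
        fun f => by rw [List.ofFn_succ_last]; simp
      rw [rows, e] at hy
      rw [e] at h0
      have := h0 _ rfl
      simp only [Option.mem_some_iff] at hy
      subst hy
      simp [row, this]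

/-- The positive row at level `0` both fixes the shift as `s` and meets the requirement on the base
diagonal. -/
theorem exists_rows_eq (s : ℕ) (l : List Row) (hl : l.length = n) (hnonneg : ∀ y ∈ l, 0 ≤ y.1)
    (hbase : ∃ y ∈ l, y.1 = 0 ∧ 0 < y.2.1)
    (h : Follows RowAdj (fun y => (s : ℤ) ≤ y.1) True (startRow s) l) :
    ∃ P : ValleyPath n, P.path.shift = s ∧ P.rows = l := by
  subst hl
  obtain ⟨hch, -, hlast⟩ := follows_iff.1 h
  have hch' : List.IsChain (fun p y => y ≤ p + 1) (((0 : ℤ) - 1) :: l.map fun y => y.1 - (s : ℤ)) := by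
    have e : ((0 : ℤ) - 1) :: l.map (fun y => y.1 - (s : ℤ)) =
        (startRow s :: l).map fun y => y.1 - (s : ℤ) := by simp [startRow]
    rw [e, List.isChain_map]
    exact hch.imp fun p y h => by have := h.1; omega
  have hlast' : ∀ a ∈ (l.map fun y => y.1 - (s : ℤ)).getLast?, 0 ≤ a := by
    intro a ha
    rw [List.getLast?_map] at ha
    obtain ⟨y, hy, rfl⟩ := Option.mem_map.1 ha
    have := hlast y hy
    omega
  have hcount := count_stepsOf 0 (l.map fun y => y.1 - (s : ℤ)) hch' (by
    intro a ha
    rcases eq_or_ne l [] with rfl | hne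
    · simp at ha; omega
    · rw [List.getLast?_cons_of_ne_nil (by simpa using hne)] at ha
      have := hlast' a ha
      omega)
  let π : SquarePath l.length :=
    { steps := stepsOf 0 (l.map fun y => y.1 - (s : ℤ))
      count_north := by simpa using hcount.1
      count_east := by
        have h1 := hcount.1
        have h2 := hcount.2
        rw [List.length_map] at h1
        omega
      ends_east := getLast_stepsOf _ _ hlast' }
  have ha : ∀ i : Fin l.length, π.a i = l[i.val].1 - s := fun i => by
    have : π.a i = (l.map fun y => y.1 - (s : ℤ))[i.val]'(by simp) := by
      simp only [SquarePath.a, π, startLevels_stepsOf 0 _ hch']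
    rw [this, List.getElem_map]
  obtain ⟨y, hy, hy0, hyw⟩ := hbase
  obtain ⟨k, hk, rfl⟩ := List.getElem_of_mem hy
  have hshift : π.shift = s := SquarePath.shift_eq
    (fun i => by rw [ha]; have := hnonneg _ (List.getElem_mem i.isLt); omega)
    ⟨⟨k, hk⟩, by rw [ha]; simp only; omega⟩
  have hadj : ∀ i : Fin l.length, ∀ j : Fin l.length, i.val + 1 = j.val →
      RowAdj l[i.val] l[j.val] := by
    rintro ⟨i, hi⟩ ⟨j, hj⟩ hij
    have := List.isChain_iff_getElem.1 hch (i + 1) (by simp at hij ⊢; omega)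
    simp only at hij
    subst hij
    simpa using this
  have hfirst : ∀ i : Fin l.length, i.val = 0 → RowAdj (startRow s) l[i.val] := by
    rintro ⟨i, hi⟩ h0
    simp only at h0
    subst h0
    simpa using List.isChain_iff_getElem.1 hch 0 (by simpa using hi)
  refine ⟨⟨π, fun i => l[i.val].2.1, Finset.univ.filter fun i => l[i.val].2.2 = true,
    ⟨fun i j hij hlt => ?_, fun i hi h0 => ?_, fun _ => ⟨⟨k, hk⟩, ?_, hyw⟩⟩, fun j hj => ?_⟩,
    hshift, ?_⟩
  · have := hadj i j hij
    rw [ha, ha] at hlt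
    simp only [RowAdj] at this
    exact (this.2.1 (by omega)).1
  · have := hfirst i hi
    rw [ha] at h0
    simp only [RowAdj, startRow] at this
    exact (this.2.1 (by omega)).1
  · rw [ha, hshift]; simp only; omega
  · have hjm : l[j.val].2.2 = true := by simpa using hj
    rcases Nat.eq_zero_or_pos j.val with h0 | h0
    · have := hfirst j h0
      simp only [RowAdj, startRow] at this
      refine Or.inl ⟨h0, ?_⟩
      rw [ha]
      grind
    · have hij : (⟨j.val - 1, by omega⟩ : Fin l.length).val + 1 = j.val := by simp only; omega
      have := hadj _ j hij
      simp only [RowAdj] at this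
      refine Or.inr ⟨_, hij, ?_⟩
      rw [ha, ha]
      grind
  · refine List.ext_getElem (by simp [rows]) fun i h1 h2 => ?_
    simp [rows, row, ha, hshift]

end ValleyPath

/-! ## Runs and diagonals -/

theorem run_natCast (z : MarkedWord) (i : ℕ) : run z i = (runs z).reverse.getD i [] := by
  simp [run]

theorem runs_eq_reverse_map (z : MarkedWord) :
    runs z = ((List.range (runs z).length).map fun i : ℕ => run z i).reverse := by
  rw [← List.reverse_eq_iff]
  refine List.ext_getElem (by simp) fun i h1 h2 => ?_
  rw [List.getElem_map, run_natCast, List.getElem_range, List.getD_eq_getElem _ _ h1]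

theorem run_ne_nil (z : MarkedWord) {i : ℕ} (hi : i < (runs z).length) : run z i ≠ [] := by
  rw [run_natCast, List.getD_eq_getElem _ _ (by simpa using hi)]
  intro h
  refine List.nil_notMem_splitBy (fun x y : Letter => decide (x.label ≤ y.label)) z ?_
  rw [← h]
  exact List.mem_reverse.1 (List.getElem_mem _)

theorem run_eq_nil (z : MarkedWord) {i : ℕ} (hi : (runs z).length ≤ i) : run z i = [] := by
  rw [run_natCast, List.getD_eq_default _ _ (by simpa using hi)]

/-- The row on the diagonal `i` with a given letter. -/
def Letter.toRow (i : ℤ) (x : Letter) : Row := (i, x.label, x.decorated)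

/-- The letter of a row. -/
def Row.letter (y : Row) : Letter := Letter.mk y.2.1 y.2.2

/-- The rows of a path of diagonal word `z`. -/
def wordRows (z : MarkedWord) : Multiset Row :=
  ∑ i ∈ Finset.range (runs z).length, ((run z i : List Letter) : Multiset Letter).map
    (Letter.toRow i)

theorem filter_wordRows (z : MarkedWord) (d : ℕ) :
    (wordRows z).filter (fun y => y.1 = (d : ℤ)) =
      ((run z d : List Letter) : Multiset Letter).map (Letter.toRow d) := by
  have h : ∀ n, (∑ i ∈ Finset.range n, ((run z i : List Letter) : Multiset Letter).map
      (Letter.toRow i)).filter (fun y => y.1 = (d : ℤ)) = if d < n then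
        ((run z d : List Letter) : Multiset Letter).map (Letter.toRow d) else 0 := by
    intro n
    induction n with
    | zero => simp
    | succ n ih =>
      rw [Finset.sum_range_succ, Multiset.filter_add, ih, Multiset.filter_map]
      rcases eq_or_ne d n with rfl | hne
      · rw [Multiset.filter_eq_self.2 (by simp [Letter.toRow])]
        simp
      · rw [Multiset.filter_eq_nil.2 (by simp [Letter.toRow]; omega)]
        by_cases hd : d < n
        · simp [hd, hd.trans]
        · simp [hd, show ¬ d < n + 1 by omega]
  rw [wordRows, h]
  split_ifs with hd
  · rfl
  · rw [run_eq_nil z (by omega)]; rfl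

theorem mem_wordRows {z : MarkedWord} {y : Row} (h : y ∈ wordRows z) :
    ∃ i < (runs z).length, y.1 = (i : ℕ) := by
  rw [wordRows, Multiset.mem_sum] at h
  obtain ⟨i, hi, h⟩ := h
  obtain ⟨x, -, rfl⟩ := Multiset.mem_map.1 h
  exact ⟨i, Finset.mem_range.1 hi, rfl⟩

theorem countP_wordRows (z : MarkedWord) (d : ℕ) (p : Letter → Prop) [DecidablePred p] :
    (wordRows z).countP (fun y => y.1 = (d : ℤ) ∧ p (Row.letter y)) = (run z d).countP fun x => p x := by
  have : (wordRows z).countP (fun y => y.1 = (d : ℤ) ∧ p (Row.letter y)) =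
      ((wordRows z).filter fun y => y.1 = (d : ℤ)).countP fun y => p (Row.letter y) := by
    rw [Multiset.countP_filter]
    exact Multiset.countP_congr rfl fun y _ => by simp [and_comm]
  rw [this, filter_wordRows, Multiset.countP_map, ← Multiset.coe_countP,
    Multiset.countP_eq_card_filter]
  rfl

theorem posCount_wordRows (z : MarkedWord) (d : ℕ) :
    posCount (wordRows z) d = (runPos z d).length := by
  rw [runPos, ← List.countP_eq_length_filter]
  have := countP_wordRows z d fun x => x.decorated = false ∧ 0 < x.label
  simp only [Bool.decide_and, Bool.decide_eq_false] at this
  rw [← this, posCount]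
  exact Multiset.countP_congr rfl fun y _ => by simp [Row.letter, Letter.mk, Letter.label,
    Letter.decorated, and_comm]

theorem count_wordRows (z : MarkedWord) (i : ℤ) :
    (wordRows z).count (i, 0, true) = decMult z i 0 := by
  rcases lt_or_ge i 0 with hi | hi
  · rw [decMult, run, if_neg (by omega), Multiset.count_eq_zero_of_notMem]
    · rfl
    · intro h
      obtain ⟨j, -, hj⟩ := mem_wordRows h
      simp only at hj
      omega
  · lift i to ℕ using hi
    have := countP_wordRows z i fun x => x = Letter.mk 0 true
    rw [decMult, List.count]
    simp only [beq_eq_decide]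
    rw [← this, Multiset.count]
    refine Multiset.countP_congr rfl fun y _ => ?_
    obtain ⟨y1, y2, y3⟩ := y
    simp [Row.letter, Letter.mk, eq_comm]

namespace ValleyPath

variable {n : ℕ}

theorem diagonal_coe (P : ValleyPath n) (d : ℕ) : ((P.diagonal d : List Letter) : Multiset Letter) =
    ((P.rows : Multiset Row).filter fun y => y.1 = (d : ℤ)).map Row.letter := by
  rw [diagonal, Multiset.sort_eq, rows_eq_map, Multiset.filter_map, Multiset.map_map]
  rfl

theorem map_toRow_diagonal (P : ValleyPath n) (d : ℕ) :
    ((P.diagonal d : List Letter) : Multiset Letter).map (Letter.toRow d) =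
      (P.rows : Multiset Row).filter fun y => y.1 = (d : ℤ) := by
  rw [diagonal_coe, Multiset.map_map]
  conv_rhs => rw [← Multiset.map_id' (Multiset.filter _ _)]
  refine Multiset.map_congr rfl fun y hy => ?_
  have := (Multiset.mem_filter.1 hy).2
  obtain ⟨y1, y2, y3⟩ := y
  simp only at this
  subst this
  rfl

theorem mem_diagonal_of_row {P : ValleyPath n} {y : Row} (hy : y ∈ P.rows) {d : ℕ}
    (hd : y.1 = (d : ℤ)) : Row.letter y ∈ P.diagonal d := by
  have : Row.letter y ∈ ((P.diagonal d : List Letter) : Multiset Letter) := by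
    rw [diagonal_coe]
    exact Multiset.mem_map_of_mem _ (Multiset.mem_filter.2 ⟨hy, hd⟩)
  exact this

theorem pairwise_diagonal (P : ValleyPath n) (d : ℕ) : (P.diagonal d).Pairwise (· ≤ ·) :=
  Multiset.pairwise_sort _ _

theorem label_le_label {x y : Letter} (h : x ≤ y) : x.label ≤ y.label := by
  rcases Prod.Lex.le_iff.1 h with h | h
  · exact h.le
  · exact h.1.le

theorem row_level_le_top {P : ValleyPath n} {y : Row} (hy : y ∈ P.rows) :
    ∃ d : ℕ, y.1 = d ∧ d ≤ P.top := by
  rw [rows, List.mem_ofFn] at hy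
  obtain ⟨i, rfl⟩ := hy
  refine ⟨(P.path.a i + P.path.shift).toNat, ?_, Finset.le_sup
    (f := fun i : Fin n => (P.path.a i + P.path.shift).toNat) (Finset.mem_univ i)⟩
  have := P.path.a_add_shift_nonneg i
  simp only [row]
  omega

theorem exists_row_top (P : ValleyPath n) (hn : 0 < n) : ∃ y ∈ P.rows, y.1 = P.top := by
  have : Nonempty (Fin n) := ⟨⟨0, hn⟩⟩
  obtain ⟨i, -, hi⟩ := Finset.exists_mem_eq_sup (Finset.univ : Finset (Fin n))
    Finset.univ_nonempty fun i : Fin n => (P.path.a i + P.path.shift).toNat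
  refine ⟨P.row i, List.mem_ofFn.2 ⟨i, rfl⟩, ?_⟩
  have := P.path.a_add_shift_nonneg i
  rw [top, hi]
  simp only [row]
  omega

/-- Below the main diagonal the path climbs from its base row back to the end; from there up it
climbs to a row of the top diagonal. -/
theorem exists_climb_rows (P : ValleyPath n) (hn : 0 < n) {d : ℕ} (hd : d < P.top) :
    ∃ u ∈ P.rows, ∃ v ∈ P.rows, u.1 = d ∧ v.1 = d + 1 ∧ u.2.1 < v.2.1 := by
  have hF := P.follows_rows
  rcases lt_or_ge d P.path.shift with h | h
  · obtain ⟨i, hi, -⟩ := P.labelling.base hn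
    obtain ⟨u, hu, v, hv, h1, h2, h3, -⟩ := exists_climb_of_lt hF (i := d) (by omega)
      (x := P.row i) (List.mem_ofFn.2 ⟨i, rfl⟩) (by simp only [row]; omega)
    exact ⟨u, hu, v, hv, h1, h2, h3⟩
  · obtain ⟨y, hy, hyt⟩ := P.exists_row_top hn
    obtain ⟨u, hu, v, hv, h1, h2, h3, -⟩ := exists_climb hF (i := d)
      (by simp only [startRow]; omega) hy (by omega)
    refine ⟨u, (List.mem_cons.1 hu).resolve_left ?_, v, hv, h1, h2, h3⟩
    rintro rfl
    simp only [startRow] at h1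
    omega

/-- The runs of the diagonal word are the diagonals. -/
theorem runs_diagonalWord (P : ValleyPath n) (hn : 0 < n) :
    runs P.diagonalWord = (List.range (P.top + 1)).reverse.map P.diagonal := by
  rw [runs, diagonalWord, List.flatMap_def]
  refine List.splitBy_flatten ?_ ?_ ?_
  · intro h
    obtain ⟨d, hd, h⟩ := List.mem_map.1 h
    rw [List.mem_reverse, List.mem_range] at hd
    rcases Nat.lt_or_ge d P.top with h' | h'
    · obtain ⟨u, hu, v, hv, h1, -⟩ := P.exists_climb_rows hn h'
      have := mem_diagonal_of_row hu h1
      rw [h] at this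
      simp at this
    · obtain ⟨y, hy, hyt⟩ := P.exists_row_top hn
      have := mem_diagonal_of_row hy (d := d) (by omega)
      rw [h] at this
      simp at this
  · intro l hl
    obtain ⟨d, -, rfl⟩ := List.mem_map.1 hl
    exact ((P.pairwise_diagonal d).imp fun h => by simpa using label_le_label h).isChain
  -- A climbing pair forces a descent between diagonals: the last label on `d + 1` is at least that
  -- of `v`, the first on `d` at most that of `u`.
  · rw [List.map_reverse, List.isChain_reverse, List.isChain_map]
    refine List.isChain_iff_getElem.2 fun d hd => ?_
    simp only [List.getElem_range]
    rw [List.length_range] at hd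
    obtain ⟨u, hu, v, hv, h1, h2, h3⟩ := P.exists_climb_rows hn (d := d) (by omega)
    have hu' := mem_diagonal_of_row hu h1
    have hv' := mem_diagonal_of_row hv (d := d + 1) (by omega)
    refine ⟨List.ne_nil_of_mem hv', List.ne_nil_of_mem hu', ?_⟩
    have k1 : Row.letter v ≤ (P.diagonal (d + 1)).getLast (List.ne_nil_of_mem hv') :=
      (P.pairwise_diagonal (d + 1)).rel_getLast hv'
    have k2 : (P.diagonal d).head (List.ne_nil_of_mem hu') ≤ Row.letter u :=
      (P.pairwise_diagonal d).rel_head hu'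
    have k3 := label_le_label k1
    have k4 := label_le_label k2
    have k5 : (Row.letter u).label = u.2.1 := rfl
    have k6 : (Row.letter v).label = v.2.1 := rfl
    exact decide_eq_false (by omega)

theorem run_diagonalWord (P : ValleyPath n) (hn : 0 < n) (d : ℕ) (hd : d ≤ P.top) :
    run P.diagonalWord d = P.diagonal d := by
  rw [run_natCast, P.runs_diagonalWord hn, List.map_reverse, List.reverse_reverse,
    List.getD_eq_getElem _ _ (by simpa using Nat.lt_succ_of_le hd)]
  simp

theorem rows_eq_wordRows (P : ValleyPath n) (hn : 0 < n) :
    (P.rows : Multiset Row) = wordRows P.diagonalWord := by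
  have hlen : (runs P.diagonalWord).length = P.top + 1 := by rw [P.runs_diagonalWord hn]; simp
  rw [wordRows, hlen, Finset.sum_congr rfl fun d hd => by
    rw [P.run_diagonalWord hn d (Nat.le_of_lt_succ (Finset.mem_range.1 hd)),
      P.map_toRow_diagonal]]
  ext y
  rw [Multiset.count_sum']
  by_cases hy : y ∈ P.rows
  · obtain ⟨d, hd, hdt⟩ := row_level_le_top hy
    rw [Finset.sum_eq_single d]
    · rw [Multiset.count_filter_of_pos (p := fun y : Row => y.1 = (d : ℤ)) hd]
    · intro i _ hne
      rw [Multiset.count_filter_of_neg]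
      omega
    · intro h
      exact absurd (Finset.mem_range.2 (Nat.lt_succ_of_le hdt)) h
  · rw [Multiset.count_eq_zero_of_notMem (by simpa using hy), eq_comm]
    exact Finset.sum_eq_zero fun i _ => Multiset.count_eq_zero_of_notMem fun h =>
      hy (Multiset.mem_filter.1 h).1

theorem pairwise_run (P : ValleyPath n) (hn : 0 < n) (d : ℕ) :
    (run P.diagonalWord d).Pairwise (· ≤ ·) := by
  rcases Nat.lt_or_ge P.top d with h | h
  · rw [run_eq_nil]
    · exact List.Pairwise.nil
    · rw [P.runs_diagonalWord hn]; simpa using h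
  · rw [P.run_diagonalWord hn d h]
    exact P.pairwise_diagonal d

/-- The rows give each diagonal as a multiset; its sorted word equals the run of `z` because that
run is sorted for the order including marks. -/
theorem diagonalWord_eq (P : ValleyPath n) {z : MarkedWord} (hn : 0 < n)
    (hz : ∀ d : ℕ, (run z d).Pairwise (· ≤ ·)) (h : (P.rows : Multiset Row) = wordRows z) :
    P.diagonalWord = z := by
  have hdiag : ∀ d : ℕ, P.diagonal d = run z d := fun d => by
    refine List.Perm.eq_of_pairwise (fun a b _ _ h1 h2 => le_antisymm h1 h2)
      (P.pairwise_diagonal d) (hz d) ?_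
    rw [← Multiset.coe_eq_coe, diagonal_coe, h, filter_wordRows, Multiset.map_map,
      show Row.letter ∘ Letter.toRow d = id from rfl, Multiset.map_id]
  have htop : P.top + 1 = (runs z).length := by
    refine le_antisymm ?_ ?_
    · obtain ⟨y, hy, hyt⟩ := P.exists_row_top hn
      obtain ⟨i, hi, hyi⟩ := mem_wordRows (z := z) (y := y) (by rw [← h]; exact hy)
      omega
    · by_contra! hlt
      have hne := run_ne_nil z (i := P.top + 1) hlt
      rw [← hdiag] at hne
      obtain ⟨x, hx⟩ := List.exists_mem_of_ne_nil _ hne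
      have hx' : x ∈ ((P.diagonal (P.top + 1) : List Letter) : Multiset Letter) := hx
      rw [diagonal_coe, Multiset.mem_map] at hx'
      obtain ⟨y, hy, -⟩ := hx'
      obtain ⟨hy, hyd⟩ := Multiset.mem_filter.1 hy
      obtain ⟨d, hd, hdt⟩ := row_level_le_top (P := P) (y := y) hy
      omega
  have hfl : (runs z).flatten = z := List.flatten_splitBy _ z
  rw [diagonalWord, htop, List.flatMap_def, List.map_reverse]
  conv_rhs => rw [← hfl, runs_eq_reverse_map z]
  congr 3
  funext d
  exact hdiag d

end ValleyPath

theorem q_ne_zero : q ≠ 0 := by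
  rw [q, Ne, FaithfulSMul.algebraMap_eq_zero_iff]
  exact MvPolynomial.X_ne_zero 0

theorem q_ne_one : q ≠ 1 := by
  rw [q, Ne, ← map_one (algebraMap (MvPolynomial (Fin 2) ℚ) QT)]
  intro h
  have := congrArg (MvPolynomial.eval fun _ => (0 : ℚ)) (IsFractionRing.injective _ QT h)
  simp at this

theorem qInt_natCast (n : ℕ) : qInt n = qNat q n := by
  rw [qInt, qNat, geom_sum_eq q_ne_one, zpow_natCast, ← neg_sub, ← neg_sub q, neg_div_neg_eq]

/-! ## The enumerators as sums over words of rows -/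

theorem length_wordRows (z : MarkedWord) : (wordRows z).card = z.length := by
  have h : (runs z).flatten = z := List.flatten_splitBy _ z
  conv_rhs => rw [← h, runs_eq_reverse_map z]
  rw [List.length_flatten, List.map_reverse, List.sum_reverse, List.map_map, wordRows]
  induction (runs z).length with
  | zero => simp
  | succ n ih =>
    rw [Finset.sum_range_succ, Multiset.card_add, ih, List.range_succ]
    simp

/-- The part of the weight of a path that is determined by its diagonal word and its shift. -/
noncomputable def wordWeight (z : MarkedWord) (s : ℕ) : MvPolynomial ℕ QT :=
  MvPolynomial.C (q ^ (((wordRows z).countP fun y => y.1 < (s : ℤ) ∧ 0 < y.2.1 : ℤ) -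
      (wordRows z).countP fun y => y.2.2 = true) * t ^ ((wordRows z).map fun y => y.1).sum) *
    ((wordRows z).map fun y =>
      if y.2.1 = 0 then (1 : MvPolynomial ℕ QT) else MvPolynomial.X y.2.1).prod

theorem weight_eq {z : MarkedWord} {s n : ℕ} (P : ValleyPath n) (hs : P.path.shift = s)
    (h : (P.rows : Multiset Row) = wordRows z) :
    P.weight = wordWeight z s * MvPolynomial.C (q ^ pairCount RowInv P.rows) := by
  rw [ValleyPath.weight, P.dinv_eq, P.area_eq, P.monomial_eq, h, hs, wordWeight, add_sub_assoc,
    zpow_add₀ q_ne_zero, zpow_natCast]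
  simp only [MvPolynomial.C_mul]
  ring

theorem length_pos_of_posCount {z : MarkedWord} (hz : 0 < posCount (wordRows z) 0) :
    0 < z.length := by
  rw [← length_wordRows]
  exact lt_of_lt_of_le hz (Multiset.countP_le_card _ _)

/-- Paths correspond bijectively to admissible arrangements of `wordRows z`, and only the inversions
vary among them. -/
theorem LSQ_eq (z : MarkedWord) (s : ℕ) (hz : 0 < posCount (wordRows z) 0)
    (hruns : ∀ d : ℕ, (run z d).Pairwise (· ≤ ·)) :
    LSQ z s = wordWeight z s * MvPolynomial.C (rowSum s (wordRows z)) := by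
  classical
  have hn := length_pos_of_posCount hz
  rw [LSQ, rowSum, wordSum, ← Finset.sum_filter, map_sum, Finset.mul_sum]
  have hrows : ∀ P ∈ (finite_pathsWithShift z s).toFinset,
      (P.rows : Multiset Row) = wordRows z ∧ P.path.shift = s := fun P hP => by
    obtain ⟨h1, h2⟩ := (Set.Finite.mem_toFinset _).1 hP
    refine ⟨?_, h2⟩
    rw [P.rows_eq_wordRows hn, h1]
  refine Finset.sum_bij (fun P _ => P.rows) (fun P hP => ?_) (fun P hP P' hP' h => ?_)
    (fun l hl => ?_) (fun P hP => weight_eq P (hrows P hP).2 (hrows P hP).1)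
  · obtain ⟨h1, h2⟩ := hrows P hP
    rw [Finset.mem_filter, mem_lists_toFinset]
    refine ⟨h1, ?_⟩
    have := P.follows_rows
    rwa [h2] at this
  · exact ValleyPath.rows_injective ((hrows P hP).2.trans (hrows P' hP').2.symm) h
  · rw [Finset.mem_filter, mem_lists_toFinset] at hl
    obtain ⟨h1, h2⟩ := hl
    obtain ⟨P, hP1, hP2⟩ := ValleyPath.exists_rows_eq (n := z.length) s l
      (by rw [← length_wordRows, ← h1]; rfl)
      (fun y hy => by
        obtain ⟨i, -, hi⟩ := mem_wordRows (z := z) (y := y) (by rw [← h1]; exact hy)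
        omega)
      (by
        obtain ⟨y, hy, hy'⟩ := Multiset.countP_pos.1 hz
        rw [← h1] at hy
        exact ⟨y, hy, hy'.1, hy'.2.1⟩) h2
    refine ⟨P, (Set.Finite.mem_toFinset _).2 ⟨?_, hP1⟩, hP2⟩
    exact P.diagonalWord_eq hn hruns (by rw [hP2, h1])

/-- Runs disregard marks, so a run may contain a marked letter before an unmarked one of the same
label; no diagonal is written that way. -/
theorem LSQ_eq_zero (z : MarkedWord) (s : ℕ) (hn : 0 < z.length)
    (hruns : ¬ ∀ d : ℕ, (run z d).Pairwise (· ≤ ·)) : LSQ z s = 0 := by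
  refine Finset.sum_eq_zero fun P hP => absurd (fun d => ?_) hruns
  obtain ⟨h1, -⟩ := (Set.Finite.mem_toFinset _).1 hP
  have := P.pairwise_run hn d
  rwa [h1] at this

/-- In b(z,s) the marked zeros are subtracted only on diagonals below `s - 1`. Together with the
marked positive labels below `s` they are the decorated rows that cost a factor q less. -/
theorem countP_positive_below (z : MarkedWord) (s : ℕ) :
    (((wordRows z).countP fun y => y.1 < (s : ℤ) ∧ 0 < y.2.1 : ℕ) : ℤ) = b z s +
      ((wordRows z).countP fun y =>
        y.1 < (s : ℤ) ∧ y.2.2 = true ∧ y ≠ ((s : ℤ) - 1, 0, true) : ℕ) := by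
  have hnonneg : ∀ y ∈ wordRows z, 0 ≤ y.1 := fun y hy => by
    obtain ⟨i, -, hi⟩ := mem_wordRows hy
    omega
  induction s with
  | zero =>
    rw [Multiset.countP_eq_zero.2 fun y hy h => by have := hnonneg y hy; omega,
      Multiset.countP_eq_zero.2 fun y hy h => by have := hnonneg y hy; omega]
    simp [b]
  | succ s ih =>
    have h1 : ((wordRows z).countP fun y => y.1 < ((s + 1 : ℕ) : ℤ) ∧ 0 < y.2.1) =
        ((wordRows z).countP fun y => y.1 < (s : ℤ) ∧ 0 < y.2.1) +
          ((wordRows z).countP fun y => y.1 = (s : ℤ) ∧ 0 < y.2.1) :=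
      countP_eq_add _ _ _ _ (by grind)
    have h2 : ((wordRows z).countP fun y => y.1 = (s : ℤ) ∧ 0 < y.2.1) =
        posCount (wordRows z) s +
          (wordRows z).countP fun y => y.1 = (s : ℤ) ∧ 0 < y.2.1 ∧ y.2.2 = true :=
      countP_eq_add _ _ _ _ (by grind)
    have h3 : ((wordRows z).countP fun y => y.1 < ((s + 1 : ℕ) : ℤ) ∧ y.2.2 = true ∧
          y ≠ (((s + 1 : ℕ) : ℤ) - 1, 0, true)) =
        ((wordRows z).countP fun y => y.1 < (s : ℤ) ∧ y.2.2 = true) +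
          ((wordRows z).countP fun y => y.1 = (s : ℤ) ∧ 0 < y.2.1 ∧ y.2.2 = true) := by
      refine countP_eq_add _ _ _ _ ?_
      rintro ⟨y1, y2, y3⟩ -
      grind
    have h4 : ((wordRows z).countP fun y => y.1 < (s : ℤ) ∧ y.2.2 = true) =
        ((wordRows z).countP fun y =>
          y.1 < (s : ℤ) ∧ y.2.2 = true ∧ y ≠ ((s : ℤ) - 1, 0, true)) +
          (wordRows z).count ((s : ℤ) - 1, 0, true) := by
      rw [Multiset.count]
      refine countP_eq_add _ _ _ _ ?_
      rintro ⟨y1, y2, y3⟩ -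
      grind
    rw [h1, h2, h3, h4, b, Finset.sum_range_succ, ← b, posCount_wordRows, count_wordRows]
    push_cast
    rw [ih]
    ring

theorem pow_mul_rowSum_wordRows (z : MarkedWord) (s : ℕ) (hz : 0 < posCount (wordRows z) 0) :
    q ^ (((wordRows z).countP fun y => y.1 < (s : ℤ) ∧ 0 < y.2.1 : ℕ) : ℤ) *
        rowSum s (wordRows z) =
      q ^ b z s * (qInt (((runPos z s).length : ℤ) - (decMult z ((s : ℤ) - 1) 0 : ℤ)) /
        qInt ((runPos z 0).length : ℤ)) * rowSum 0 (wordRows z) := by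
  obtain ⟨h1, h2⟩ := rowSum_comparison s (wordRows z) (fun y hy => by
    obtain ⟨i, -, hi⟩ := mem_wordRows hy
    omega) hz
  have hp0 : posCount (wordRows z) 0 = (runPos z 0).length := posCount_wordRows z 0
  have h0 : qInt ((runPos z 0).length : ℤ) ≠ 0 := by
    rw [qInt_natCast, ← hp0]
    obtain ⟨n, hn⟩ := Nat.exists_eq_succ_of_ne_zero hz.ne'
    rw [hn]
    exact qNat_ne_zero n
  rw [count_wordRows, posCount_wordRows, hp0, ← qInt_natCast] at h1
  rw [count_wordRows, posCount_wordRows] at h2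
  -- Truncated and integer differences disagree only when marked zeros outnumber the available gaps,
  -- and then `rowSum 0` vanishes.
  have h3 : qNat q ((runPos z s).length - decMult z ((s : ℤ) - 1) 0) * rowSum 0 (wordRows z) =
      qInt (((runPos z s).length : ℤ) - (decMult z ((s : ℤ) - 1) 0 : ℤ)) *
        rowSum 0 (wordRows z) := by
    rcases lt_or_ge (runPos z s).length (decMult z ((s : ℤ) - 1) 0) with h | h
    · rw [h2 h, mul_zero, mul_zero]
    · rw [← Nat.cast_sub h, qInt_natCast]
  rw [h3] at h1
  rw [countP_positive_below, zpow_add₀ q_ne_zero, zpow_natCast]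
  field_simp
  linear_combination q ^ b z s * h1

end DeltaSquare

theorem mainTheorem3 (z : DeltaSquare.MarkedWord) (s : ℕ)
    (hz : (DeltaSquare.runPos z 0).length ≠ 0) :
    DeltaSquare.LSQ z s =
      MvPolynomial.C
        (DeltaSquare.q ^ DeltaSquare.b z s *
          (DeltaSquare.qInt
              (((DeltaSquare.runPos z s).length : ℤ)
                - (DeltaSquare.decMult z ((s : ℤ) - 1) 0 : ℤ)) /
            DeltaSquare.qInt ((DeltaSquare.runPos z 0).length : ℤ))) *
        DeltaSquare.LD z := by
  have hLD : DeltaSquare.LD z = DeltaSquare.LSQ z 0 := rfl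
  have hz' : 0 < DeltaSquare.posCount (DeltaSquare.wordRows z) 0 :=
    Nat.pos_of_ne_zero fun h => hz ((DeltaSquare.posCount_wordRows z 0).symm.trans h)
  by_cases hruns : ∀ d : ℕ, (DeltaSquare.run z d).Pairwise (· ≤ ·)
  · have h := DeltaSquare.pow_mul_rowSum_wordRows z s hz'
    have h0 : (DeltaSquare.wordRows z).countP (fun y => y.1 < ((0 : ℕ) : ℤ) ∧ 0 < y.2.1) = 0 :=
      Multiset.countP_eq_zero.2 fun y hy h => by
        obtain ⟨i, -, hi⟩ := DeltaSquare.mem_wordRows hy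
        omega
    rw [hLD, DeltaSquare.LSQ_eq z s hz' hruns, DeltaSquare.LSQ_eq z 0 hz' hruns,
      DeltaSquare.wordWeight, DeltaSquare.wordWeight, h0, mul_right_comm, ← MvPolynomial.C_mul,
      mul_right_comm _ _ (MvPolynomial.C (DeltaSquare.rowSum _ _)), ← mul_assoc,
      ← MvPolynomial.C_mul, ← MvPolynomial.C_mul]
    congr 2
    have hsub : ∀ a b : ℤ, DeltaSquare.q ^ (a - b) = DeltaSquare.q ^ a * DeltaSquare.q ^ (-b) :=
      fun a b => by rw [sub_eq_add_neg, zpow_add₀ DeltaSquare.q_ne_zero]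
    simp only [hsub, Nat.cast_zero, zpow_zero]
    linear_combination (DeltaSquare.q ^ (-((DeltaSquare.wordRows z).countP
      fun y => y.2.2 = true : ℤ)) *
      DeltaSquare.t ^ ((DeltaSquare.wordRows z).map fun y => y.1).sum) * h
  -- If some run is not sorted with marks, `z` is no diagonal word and both enumerators are empty.
  · have hn := DeltaSquare.length_pos_of_posCount hz'
    rw [hLD, DeltaSquare.LSQ_eq_zero z s hn hruns, DeltaSquare.LSQ_eq_zero z 0 hn hruns, mul_zero]
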